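/- Let $(V,\omega)$ be a finite-dimensional real symplectic vector space, and let $\mathcal L$ be the space of linear complex structures $J$ on $V$ compatible with $\omega$ ($J^2=-1$, $\omega(Ju,Jv)=\omega(u,v)$, $\omega(v,Jv)>0$ for $v\neq 0$), a submanifold of $\operatorname{End}(V)$ on which $\mathrm{Sp}(V)$ acts by conjugation. For $J\in\mathcal L$ let $\mathfrak p_J=\{A\in\mathfrak{sp}(V): AJ=-JA\}$. The map $A\mapsto [A,J]$ identifies $\mathfrak p_J$ with $T_J\mathcal L$; under this identification put $$\Omega_J([A,J],[B,J])=\operatorname{tr}(AJB),\qquad A,B\in\mathfrak p_J .$$ Fix $J_0\in\mathcal L$ and a Haar (Lebesgue) measure $\mu$ on $V$, for example $\mu=|\omega^n|$ with $2n=\dim V$. Let $$\mathcal B=\{f:V\to\mathbb C \;:\; df\circ J_0=i\,df\}\cap L^2\bigl(V,e^{-\omega(v,J_0v)}\,d\mu(v)\bigr)$$ be the Bargmann space. Write $h(v,w)=\omega(v,J_0w)-i\,\omega(v,w)$, and let the Heisenberg group act on $\mathcal B$ through the unitary operators $$(W_wf)(v)=e^{h(v,w)-\frac12h(w,w)}f(v-w),\qquad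 w\in V.$$ Let $d\rho(w)=\frac{d}{dt}\big|_{t=0}W_{tw}$, extended complex linearly to $w\in V\otimes\mathbb C$. For $J\in\mathcal L$ let $\mathcal R_J\subset\mathcal B$ be the space of ground states of $J$, i.e. the joint kernel of the operators $d\rho(\xi)$, where $\xi$ runs over the complex Lagrangian subspace of vectors $\xi\in V\otimes\mathbb C$ of type $(1,0)$, $J\xi=i\xi$. Then: 1. The spaces $\mathcal R_J$ are one-dimensional and are the fibres of a smooth complex line bundle $\mathcal R\to\mathcal L$ (near every point of $\mathcal L$ there is a nowhere vanishing section that is smooth as a map into the Hilbert space). 2. $\Omega$ is an $\mathrm{Sp}(V)$-invariant symplectic form on $\mathcal L$ (alternating, nondegenerate, closed). 3. The curvature of the $L^2$ connection on $\mathcal R$ is the symplectic form $\Omega$ times the universal constant $\frac i2$. Explicitly, let $J(s,t)$ be a smooth two-parameter family in $\mathcal L$, let $\psi(s,t)\in\mathcal R_{J(s,t)}$ be a smooth lift, and put $D_s\psi=P_{J(s,t)}(\partial_s\psi)$, $D_t\psi=P_{J(s,t)}(\partial_t\psi)$, where $P_J$ is the orthogonal projection onto $\mathcal R_J$. Then $$D_sD_t\psi-D_tD_s\psi=\tfrac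 i2\,\Omega_{J}(\partial_sJ,\partial_tJ)\,\psi .$$ -/

import Mathlib

open MeasureTheory

noncomputable section

/-! ### Line subbundles of a fixed Hilbert space and their `L²` connection -/

/-- The `i`-th partial derivative of a map defined on `ℝᵏ`. -/
def pd {k : ℕ} {E : Type*} [NormedAddCommGroup E] [NormedSpace ℝ E]
    (i : Fin k) (f : (Fin k → ℝ) → E) (p : Fin k → ℝ) : E :=
  fderiv ℝ f p (Pi.single i 1)

section Connection

variable {X : Type*} [NormedAddCommGroup X] [NormedSpace ℝ X]
variable {H : Type*} [NormedAddCommGroup H] [InnerProductSpace ℂ H] [CompleteSpace H]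

/-- The subspaces `R J` of the Hilbert space `H`, with `J` running over the submanifold `M` of the
vector space `X`, are the fibres of a smooth complex line bundle over `M`: they are lines, and near
every point of `M` there is a smooth nowhere vanishing section (smooth on a subset of `X`: locally
the restriction of a smooth map on an open set). -/
def IsSmoothLineBundle (M : Set X) (R : X → Submodule ℂ H) : Prop :=
  (∀ J ∈ M, Module.finrank ℂ (R J) = 1) ∧
  ∀ J₁ ∈ M, ∃ (O : Set X) (s : X → H), IsOpen O ∧ J₁ ∈ O ∧ ContDiffOn ℝ (⊤ : ℕ∞) s O ∧
    ∀ J ∈ O ∩ M, s J ∈ R J ∧ s J ≠ 0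

/-- The covariant derivative, in the direction of the `i`-th parameter, of a lift `ψ` of a
`k`-parameter family `γ`: differentiate in the ambient Hilbert space, then project orthogonally
onto the fibre. (The closure is there only so that the projection exists for every subspace;
finite-dimensional fibres are closed.) -/
def covD {k : ℕ} (R : X → Submodule ℂ H) (γ : (Fin k → ℝ) → X) (i : Fin k)
    (ψ : (Fin k → ℝ) → H) (p : Fin k → ℝ) : H :=
  (R (γ p)).topologicalClosure.starProjection (pd i ψ p)

/-- `F` is the curvature of the `L²` connection `D` of the line bundle `R` over `M`: for every
smooth two-parameter family `γ` in `M` and every smooth lift `ψ` of `γ` to `R`,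
`D₀ D₁ ψ - D₁ D₀ ψ = F(∂₀γ, ∂₁γ) ψ`. -/
def IsCurvatureForm (M : Set X) (R : X → Submodule ℂ H) (F : X → X → X → ℂ) : Prop :=
  ∀ (U : Set (Fin 2 → ℝ)) (γ : (Fin 2 → ℝ) → X) (ψ : (Fin 2 → ℝ) → H), IsOpen U →
    ContDiffOn ℝ (⊤ : ℕ∞) γ U → (∀ p ∈ U, γ p ∈ M) →
    ContDiffOn ℝ (⊤ : ℕ∞) ψ U → (∀ p ∈ U, ψ p ∈ R (γ p)) →
    ∀ p ∈ U, covD R γ 0 (covD R γ 1 ψ) p - covD R γ 1 (covD R γ 0 ψ) p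
      = F (γ p) (pd 0 γ p) (pd 1 γ p) • ψ p

end Connection

section Symplectic

variable {V : Type*} [NormedAddCommGroup V] [NormedSpace ℝ V]

/-! ### Compatible complex structures -/

/-- The linear complex structures on `V` that are compatible with `ω`. -/
def compatibleJ (ω : LinearMap.BilinForm ℝ V) : Set (V →L[ℝ] V) :=
  {J | (∀ v, J (J v) = -v) ∧ (∀ u v, ω (J u) (J v) = ω u v) ∧ ∀ v, v ≠ 0 → 0 < ω v (J v)}

/-- The tangent space at `J` of the space of compatible complex structures. -/
def tangentJ (ω : LinearMap.BilinForm ℝ V) (J : V →L[ℝ] V) : Set (V →L[ℝ] V) :=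
  {X | (∀ v, J (X v) + X (J v) = 0) ∧ ∀ u v, ω (X u) (J v) + ω (J u) (X v) = 0}

/-- For `X` tangent at `J`, the unique element `A` of the `𝔭`-part at `J` of `sp(V)`
(`A` infinitesimally symplectic, `A J = - J A`) whose infinitesimal action on complex structures
is `X`, that is `[A, J] = X`; see `pPart_spec` and `pPart_unique`. -/
def pPart (J X : V →L[ℝ] V) : V →L[ℝ] V := -((1 / 2 : ℝ) • (X ∘L J))

theorem pPart_spec {ω : LinearMap.BilinForm ℝ V} {J X : V →L[ℝ] V}
    (hJ : J ∈ compatibleJ ω) (hX : X ∈ tangentJ ω J) :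
    (∀ v, pPart J X (J v) = -J (pPart J X v)) ∧
    (∀ u v, ω (pPart J X u) v + ω u (pPart J X v) = 0) ∧
    (∀ v, pPart J X (J v) - J (pPart J X v) = X v) := by
  obtain ⟨h1, h2, -⟩ := hJ
  obtain ⟨h3, h4⟩ := hX
  have h5 : ∀ v, J (X v) = -X (J v) := fun v => eq_neg_of_add_eq_zero_left (h3 v)
  have h6 : ∀ v, pPart J X (J v) = (1 / 2 : ℝ) • X v := fun v => by
    simp [pPart, h1]
  have h7 : ∀ v, J (pPart J X v) = -((1 / 2 : ℝ) • X v) := fun v => by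
    simp [pPart, h5, h1]
  refine ⟨fun v => by rw [h6, h7, neg_neg], fun u v => ?_, fun v => ?_⟩
  · have e := h4 u v
    have a : ω (pPart J X u) v = ω (J (pPart J X u)) (J v) := (h2 _ _).symm
    have b : ω u (pPart J X v) = ω (J u) (J (pPart J X v)) := (h2 _ _).symm
    rw [a, b, h7, h7]
    simp only [map_neg, map_smul, LinearMap.neg_apply, LinearMap.smul_apply, smul_eq_mul]
    linarith
  · rw [h6, h7, sub_neg_eq_add, ← add_smul]
    norm_num

theorem pPart_unique {ω : LinearMap.BilinForm ℝ V} {J X A : V →L[ℝ] V}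
    (hJ : J ∈ compatibleJ ω) (hA : ∀ v, A (J v) = -J (A v))
    (hAX : ∀ v, A (J v) - J (A v) = X v) : A = pPart J X := by
  ext v
  have h : J (J v) = -v := hJ.1 v
  have e := hAX (J v)
  rw [h, ← neg_eq_iff_eq_neg.mpr (hA (J v)), h, sub_neg_eq_add] at e
  have e2 : X (J v) = -((2 : ℝ) • A v) := by
    rw [← e, two_smul, map_neg]; abel
  simp [pPart, e2, smul_smul]

/-- The form `Ω` on the space of compatible complex structures: it is `tr (A J B)` on elements
`A`, `B` of the `𝔭`-part at `J`, transported to tangent vectors `X = [A, J]`, `Y = [B, J]`. -/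
def sympForm (J : V →L[ℝ] V) : LinearMap.BilinForm ℝ (V →L[ℝ] V) :=
  LinearMap.mk₂ ℝ
    (fun X Y => LinearMap.trace ℝ V (pPart J X ∘L J ∘L pPart J Y : V →L[ℝ] V).toLinearMap)
    (fun X X' Y => by
      rw [← map_add]; congr 1; ext v; simp [pPart]; try abel)
    (fun c X Y => by
      rw [← map_smul]; congr 1; ext v; simp [pPart, smul_smul]; try ring_nf)
    (fun X Y Y' => by
      rw [← map_add]; congr 1; ext v; simp [pPart]; try abel)
    (fun c X Y => by
      rw [← map_smul]; congr 1; ext v; simp [pPart, smul_smul]; try ring_nf)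

/-- `Ω` is an `Sp(V)`-invariant symplectic form on the space of compatible complex structures:
alternating and nondegenerate on each tangent space, closed, and invariant under conjugation by
linear symplectic maps. Closedness is the vanishing of the exterior derivative of the pull-back
of `Ω` by every smooth three-parameter family. -/
def IsInvariantSymplecticForm (ω : LinearMap.BilinForm ℝ V)
    (Ω : (V →L[ℝ] V) → LinearMap.BilinForm ℝ (V →L[ℝ] V)) : Prop :=
  (∀ J ∈ compatibleJ ω, ∀ X ∈ tangentJ ω J, Ω J X X = 0) ∧
  (∀ J ∈ compatibleJ ω, ∀ X ∈ tangentJ ω J, (∀ Y ∈ tangentJ ω J, Ω J X Y = 0) → X = 0) ∧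
  (∀ γ : (Fin 3 → ℝ) → (V →L[ℝ] V), ContDiff ℝ (⊤ : ℕ∞) γ → (∀ p, γ p ∈ compatibleJ ω) → ∀ p,
    pd 0 (fun q => Ω (γ q) (pd 1 γ q) (pd 2 γ q)) p
    + pd 1 (fun q => Ω (γ q) (pd 2 γ q) (pd 0 γ q)) p
    + pd 2 (fun q => Ω (γ q) (pd 0 γ q) (pd 1 γ q)) p = 0) ∧
  (∀ g : V ≃L[ℝ] V, (∀ u v, ω (g u) (g v) = ω u v) →
    ∀ J ∈ compatibleJ ω, ∀ X ∈ tangentJ ω J, ∀ Y ∈ tangentJ ω J,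
      Ω ((g : V →L[ℝ] V) ∘L J ∘L (g.symm : V →L[ℝ] V))
        ((g : V →L[ℝ] V) ∘L X ∘L (g.symm : V →L[ℝ] V))
        ((g : V →L[ℝ] V) ∘L Y ∘L (g.symm : V →L[ℝ] V)) = Ω J X Y)

/-! ### Bargmann space, Heisenberg representation, ground states -/

/-- `J`-holomorphic functions: `df ∘ J = i df`. -/
def IsHolo (J : V →L[ℝ] V) (f : V → ℂ) : Prop :=
  Differentiable ℝ f ∧ ∀ v w, fderiv ℝ f v (J w) = Complex.I * fderiv ℝ f v w

/-- The Hermitian form of `(ω, J)`, complex linear in `v` and antilinear in `w`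
(`∑ v_j conj(w_j)` in unitary coordinates). -/
def hermForm (ω : LinearMap.BilinForm ℝ V) (J : V →L[ℝ] V) (v w : V) : ℂ :=
  (ω v (J w) : ℂ) - Complex.I * (ω v w : ℂ)

/-- The Heisenberg representation on functions: the unitary operator of the element `w ∈ V` of
the Heisenberg group (the centre acts by scalars). -/
def heis (ω : LinearMap.BilinForm ℝ V) (J₀ : V →L[ℝ] V) (w : V) (f : V → ℂ) (v : V) : ℂ :=
  Complex.exp (hermForm ω J₀ v w - hermForm ω J₀ w w / 2) * f (v - w)

/-- The operator of `w ∈ V` in the representation of the Heisenberg Lie algebra. -/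
def dHeis (ω : LinearMap.BilinForm ℝ V) (J₀ : V →L[ℝ] V) (w : V) (f : V → ℂ) (v : V) : ℂ :=
  deriv (fun t : ℝ => heis ω J₀ (t • w) f v) 0

/-- Its complex linear extension to the complexification of `V`; the pair `(a, b)` stands for
the complex vector `a + i b`. -/
def dHeisC (ω : LinearMap.BilinForm ℝ V) (J₀ : V →L[ℝ] V) (ξ : V × V) (f : V → ℂ) (v : V) : ℂ :=
  dHeis ω J₀ ξ.1 f v + Complex.I * dHeis ω J₀ ξ.2 f v

/-- The complex Lagrangian subspace of the complexification of `V` attached to `J`: the vectors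
`a + i b` of type `(1,0)`, that is `J (a + i b) = i (a + i b)`. -/
def lagr (J : V →L[ℝ] V) : Set (V × V) := {ξ | J ξ.1 = -ξ.2 ∧ J ξ.2 = ξ.1}

theorem heis_add (ω : LinearMap.BilinForm ℝ V) (J₀ : V →L[ℝ] V) (w : V) (f g : V → ℂ) (v : V) :
    heis ω J₀ w (f + g) v = heis ω J₀ w f v + heis ω J₀ w g v := by
  simp [heis, mul_add]

theorem heis_smul (ω : LinearMap.BilinForm ℝ V) (J₀ : V →L[ℝ] V) (w : V) (c : ℂ) (f : V → ℂ)
    (v : V) : heis ω J₀ w (c • f) v = c * heis ω J₀ w f v := by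
  simp [heis, mul_left_comm]

theorem heis_differentiableAt (ω : LinearMap.BilinForm ℝ V) (J₀ : V →L[ℝ] V) (w : V) {f : V → ℂ}
    (hf : Differentiable ℝ f) (v : V) :
    DifferentiableAt ℝ (fun t : ℝ => heis ω J₀ (t • w) f v) 0 := by
  have h1 : DifferentiableAt ℝ (fun t : ℝ => f (v - t • w)) 0 :=
    (hf _).comp (0 : ℝ) (by fun_prop)
  have h2 : DifferentiableAt ℝ (fun t : ℝ => (t : ℂ)) 0 :=
    Complex.ofRealCLM.differentiableAt
  simp only [heis, hermForm, map_smul, LinearMap.smul_apply, smul_eq_mul, Complex.ofReal_mul]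
  refine DifferentiableAt.mul (DifferentiableAt.cexp ?_) h1
  fun_prop

variable [MeasurableSpace V]

/-- The Gaussian measure `exp (-ω(v, J₀ v)) dμ(v)`. -/
def gaussMeasure (μ : Measure V) (ω : LinearMap.BilinForm ℝ V) (J₀ : V →L[ℝ] V) : Measure V :=
  μ.withDensity (fun v => ENNReal.ofReal (Real.exp (-(ω v (J₀ v)))))

/-- The Bargmann space: the square integrable `J₀`-holomorphic functions, as a subspace of
`L²(V, exp (-ω(v, J₀ v)) dμ(v))`. -/
def bargmann (μ : Measure V) (ω : LinearMap.BilinForm ℝ V) (J₀ : V →L[ℝ] V) :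
    Submodule ℂ (Lp ℂ 2 (gaussMeasure μ ω J₀)) where
  carrier := {F | ∃ f : V → ℂ, IsHolo J₀ f ∧ F =ᵐ[gaussMeasure μ ω J₀] f}
  add_mem' := by
    rintro F G ⟨f, hf, hFf⟩ ⟨g, hg, hGg⟩
    refine ⟨f + g, ⟨hf.1.add hg.1, fun v w => ?_⟩, (Lp.coeFn_add F G).trans (hFf.add hGg)⟩
    rw [fderiv_add (hf.1 v) (hg.1 v)]
    simp [hf.2, hg.2, mul_add]
  zero_mem' := ⟨0, ⟨differentiable_const 0, fun v w => by simp⟩, Lp.coeFn_zero _ _ _⟩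
  smul_mem' := by
    rintro c F ⟨f, hf, hFf⟩
    refine ⟨c • f, ⟨hf.1.const_smul c, fun v w => ?_⟩,
      (Lp.coeFn_smul c F).trans (hFf.const_smul c)⟩
    rw [fderiv_const_smul (hf.1 v)]
    simp [hf.2, mul_left_comm]

/-- The ground states of `J`: the joint kernel in the Bargmann space of the operators of all
the vectors of the complex Lagrangian subspace of `J`. -/
def groundLine (μ : Measure V) (ω : LinearMap.BilinForm ℝ V) (J₀ J : V →L[ℝ] V) :
    Submodule ℂ (Lp ℂ 2 (gaussMeasure μ ω J₀)) where
  carrier := {F | ∃ f : V → ℂ, IsHolo J₀ f ∧ F =ᵐ[gaussMeasure μ ω J₀] f ∧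
    ∀ ξ ∈ lagr J, ∀ v, dHeisC ω J₀ ξ f v = 0}
  add_mem' := by
    rintro F G ⟨f, hf, hFf, kf⟩ ⟨g, hg, hGg, kg⟩
    refine ⟨f + g, ⟨hf.1.add hg.1, fun v w => ?_⟩, (Lp.coeFn_add F G).trans (hFf.add hGg),
      fun ξ hξ v => ?_⟩
    · rw [fderiv_add (hf.1 v) (hg.1 v)]
      simp [hf.2, hg.2, mul_add]
    · have e : ∀ w, dHeis ω J₀ w (f + g) v = dHeis ω J₀ w f v + dHeis ω J₀ w g v := fun w => by
        simp only [dHeis, heis_add]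
        exact deriv_add (heis_differentiableAt ω J₀ w hf.1 v)
          (heis_differentiableAt ω J₀ w hg.1 v)
      have a := kf ξ hξ v
      have b := kg ξ hξ v
      simp only [dHeisC, e] at a b ⊢
      linear_combination a + b
  zero_mem' := ⟨0, ⟨differentiable_const 0, fun v w => by simp⟩, Lp.coeFn_zero _ _ _,
    fun ξ _ v => by simp [dHeisC, dHeis, heis]⟩
  smul_mem' := by
    rintro c F ⟨f, hf, hFf, kf⟩
    refine ⟨c • f, ⟨hf.1.const_smul c, fun v w => ?_⟩,
      (Lp.coeFn_smul c F).trans (hFf.const_smul c), fun ξ hξ v => ?_⟩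
    · rw [fderiv_const_smul (hf.1 v)]
      simp [hf.2, mul_left_comm]
    · have e : ∀ w, dHeis ω J₀ w (c • f) v = c * dHeis ω J₀ w f v := fun w => by
        simp only [dHeis, heis_smul]
        exact deriv_const_mul c (heis_differentiableAt ω J₀ w hf.1 v)
      have a := kf ξ hξ v
      simp only [dHeisC, e] at a ⊢
      linear_combination c * a

theorem groundLine_le_bargmann (μ : Measure V) (ω : LinearMap.BilinForm ℝ V)
    (J₀ J : V →L[ℝ] V) : groundLine μ ω J₀ J ≤ bargmann μ ω J₀ :=
  fun _ ⟨f, hf, hFf, _⟩ => ⟨f, hf, hFf⟩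

end Symplectic

end

/-! Everything is read off from an explicit spanning section. Put `K = (J₀ + J)⁻¹`; the inverse
exists because `ω(v, (J₀ + J) v) > 0` for `v ≠ 0`. The operator of `w` is `h(·, w) - ∂_w`, and `u ↦
J K u + i K u` parametrises the `(1,0)` vectors of `J`. On `J₀`-holomorphic functions the ground
state equations therefore become `df = λ f`, with `λ` a symmetric bilinear form
(`ground_equation_iff`, `logForm_symm`). The solutions are the multiples of one Gaussian, `exp (λ(v,
v) / 2)`. Its squared modulus times the weight is `exp (2 ω(v, K v))`, integrable because `ω(v, K v)
< 0` (`sumInv_neg`). This gives one-dimensionality (`groundLine_eq_span`).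

The Gaussian is an exponential family whose phase is linear in `K`. Such families are smooth into
`L²` wherever some integrability is left to spare (`contDiffOn_toL2_expFun`), and `K` is smooth in
`J`.

For the curvature, let `s` be this section. The coefficient `a(X) = ⟨s, ∂_X s⟩ / ⟨s, s⟩` is a ratio
of Gaussian second moments, hence a trace: `a(X) = 1/4 tr(X K) + i/4 tr(J₀ K X)`
(`integral_groundPhase`). The first term is closed, being the differential of `1/4 log |det (J₀ +
J)|`. The second contributes `i/4 (tr(J₀ K Y K X) - tr(J₀ K X K Y))`, and `opTrace_sumInv_curvature`
evaluates the bracket as `2 Ω(X, Y)`.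

That `Ω` is symplectic follows from `Ω(X, Y) = -1/4 tr(X Y J)` and the anticommutation of tangent
vectors with `J`. -/

noncomputable section

/-! ### Smoothness of exponential families of square integrable functions -/

section ExponentialFamily

open Filter Topology Asymptotics

variable {α : Type*} [MeasurableSpace α] {ν : Measure α}
variable {E : Type*} [NormedAddCommGroup E] [NormedSpace ℝ E]

open Classical in
/-- The class in `L²` of a function, zero if the function is not square integrable. -/
def toL2 (ν : Measure α) (f : α → ℂ) : Lp ℂ 2 ν :=
  if h : MemLp f 2 ν then h.toLp f else 0

theorem coeFn_toL2 {f : α → ℂ} (h : MemLp f 2 ν) : toL2 ν f =ᵐ[ν] f := by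
  rw [toL2, dif_pos h]
  exact h.coeFn_toLp

theorem toL2_add {f g : α → ℂ} (hf : MemLp f 2 ν) (hg : MemLp g 2 ν) :
    toL2 ν (f + g) = toL2 ν f + toL2 ν g := by
  rw [toL2, toL2, toL2, dif_pos hf, dif_pos hg, dif_pos (hf.add hg)]
  rfl

theorem toL2_smul {f : α → ℂ} (c : ℝ) (hf : MemLp f 2 ν) :
    toL2 ν (c • f) = c • toL2 ν f := by
  rw [toL2, toL2, dif_pos hf, dif_pos (hf.const_smul c)]
  rfl

/-- The member with parameter `A` of the exponential family with prefactor `P` and phase `q`. -/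
def expFun (q : E →ₗ[ℝ] α → ℂ) (P : α → ℂ) (A : E) (a : α) : ℂ := P a * Complex.exp (q A a)

/-- The member with parameter `A` of the exponential family is square integrable with some room
to spare, measured by the weight `w`. -/
def ExpDom (ν : Measure α) (q : E →ₗ[ℝ] α → ℂ) (w : α → ℝ) (P : α → ℂ) (A : E) : Prop :=
  ∃ ε > 0, MemLp (fun a => Real.exp (ε * w a) * ‖expFun q P A a‖) 2 ν

variable {q : E →ₗ[ℝ] α → ℂ} {w : α → ℝ} {P : α → ℂ} {A : E}

theorem aestronglyMeasurable_expFun (hqm : ∀ B, AEStronglyMeasurable (q B) ν)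
    (hP : AEStronglyMeasurable P ν) (A : E) : AEStronglyMeasurable (expFun q P A) ν :=
  hP.mul (Complex.continuous_exp.comp_aestronglyMeasurable (hqm A))

/-- This is `t² / 2 ≤ exp t` at `t = ε x / 2`. -/
theorem sq_le_exp {ε x : ℝ} (hε : 0 < ε) (hx : 0 ≤ x) :
    x ^ 2 ≤ 8 / ε ^ 2 * Real.exp (ε / 2 * x) := by
  have h := Real.pow_div_factorial_le_exp (ε / 2 * x) (by positivity) 2
  have e : x ^ 2 = 8 / ε ^ 2 * ((ε / 2 * x) ^ 2 / (Nat.factorial 2 : ℝ)) := by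
    norm_num [Nat.factorial]; field_simp; norm_num
  rw [e]
  exact mul_le_mul_of_nonneg_left h (by positivity)

theorem le_exp {ε x : ℝ} (hε : 0 < ε) : x ≤ 2 / ε * Real.exp (ε / 2 * x) := by
  have h : ε / 2 * x ≤ Real.exp (ε / 2 * x) := by linarith [Real.add_one_le_exp (ε / 2 * x)]
  have e : x = 2 / ε * (ε / 2 * x) := by field_simp
  calc x = 2 / ε * (ε / 2 * x) := e
    _ ≤ _ := mul_le_mul_of_nonneg_left h (by positivity)

theorem memLp_expFun (hqm : ∀ B, AEStronglyMeasurable (q B) ν) (hw : ∀ a, 0 ≤ w a)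
    (hP : AEStronglyMeasurable P ν) (h : ExpDom ν q w P A) : MemLp (expFun q P A) 2 ν := by
  obtain ⟨ε, hε, h⟩ := h
  refine h.mono' (aestronglyMeasurable_expFun hqm hP A) (Eventually.of_forall fun a => ?_)
  exact le_mul_of_one_le_left (norm_nonneg _) (Real.one_le_exp (mul_nonneg hε.le (hw a)))

/-- Moving the parameter by less than `ε / 2` costs at most a factor `exp (ε w / 2)`: half of the
spare room pays for it and half remains. -/
theorem isOpen_expDom (hq : ∀ B a, ‖q B a‖ ≤ ‖B‖ * w a) (hqm : ∀ B, AEStronglyMeasurable (q B) ν)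
    (hw : ∀ a, 0 ≤ w a) (hwm : Measurable w) (hP : AEStronglyMeasurable P ν) :
    IsOpen {A | ExpDom ν q w P A} := by
  refine Metric.isOpen_iff.2 fun A ⟨ε, hε, hA⟩ => ⟨ε / 2, half_pos hε, fun B hB => ?_⟩
  refine ⟨ε / 2, half_pos hε, hA.mono' ?_ (Eventually.of_forall fun a => ?_)⟩
  · exact (Real.measurable_exp.comp (hwm.const_mul _)).aestronglyMeasurable.mul
      (aestronglyMeasurable_expFun hqm hP B).norm
  · have h1 : (q B a).re ≤ (q A a).re + ε / 2 * w a := by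
      have h2 : (q (B - A) a).re ≤ ‖q (B - A) a‖ := Complex.re_le_norm _
      have h3 := hq (B - A) a
      have h4 : ‖B - A‖ ≤ ε / 2 := by
        rw [← dist_eq_norm]; exact (Metric.mem_ball.1 hB).le
      have h5 := mul_le_mul_of_nonneg_right h4 (hw a)
      simp only [map_sub, Pi.sub_apply, Complex.sub_re] at h2 h3
      linarith
    simp only [expFun, norm_mul, Complex.norm_exp, Real.norm_eq_abs, Real.abs_exp, abs_norm]
    calc Real.exp (ε / 2 * w a) * (‖P a‖ * Real.exp (q B a).re)
        ≤ Real.exp (ε / 2 * w a) * (‖P a‖ * Real.exp ((q A a).re + ε / 2 * w a)) := by gcongr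
      _ = Real.exp (ε / 2 * w a + ε / 2 * w a) * (‖P a‖ * Real.exp (q A a).re) := by
        rw [Real.exp_add, Real.exp_add]; ring
      _ = _ := by ring_nf

/-- A factor `q B` grows at most linearly in `w`, so it too is absorbed by half of the room. This
keeps all derivatives of the family square integrable. -/
theorem ExpDom.mul_phase (hq : ∀ B a, ‖q B a‖ ≤ ‖B‖ * w a)
    (hqm : ∀ B, AEStronglyMeasurable (q B) ν) (hwm : Measurable w)
    (hP : AEStronglyMeasurable P ν) (h : ExpDom ν q w P A) (B : E) :
    ExpDom ν q w (P * q B) A := by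
  obtain ⟨ε, hε, h⟩ := h
  refine ⟨ε / 2, half_pos hε, (h.const_mul (‖B‖ * (2 / ε))).mono' ?_
    (Eventually.of_forall fun a => ?_)⟩
  · exact (Real.measurable_exp.comp (hwm.const_mul _)).aestronglyMeasurable.mul
      (aestronglyMeasurable_expFun hqm (hP.mul (hqm B)) A).norm
  · have h1 : ‖q B a‖ ≤ ‖B‖ * (2 / ε * Real.exp (ε / 2 * w a)) :=
      (hq B a).trans (mul_le_mul_of_nonneg_left (le_exp hε) (norm_nonneg _))
    simp only [expFun, Pi.mul_apply, norm_mul, Real.norm_eq_abs, Real.abs_exp, abs_norm]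
    calc Real.exp (ε / 2 * w a) * (‖P a‖ * ‖q B a‖ * ‖Complex.exp (q A a)‖)
        ≤ Real.exp (ε / 2 * w a) * (‖P a‖ * (‖B‖ * (2 / ε * Real.exp (ε / 2 * w a))) *
          ‖Complex.exp (q A a)‖) := by gcongr
      _ = ‖B‖ * (2 / ε) * (Real.exp (ε / 2 * w a + ε / 2 * w a) *
          (‖P a‖ * ‖Complex.exp (q A a)‖)) := by rw [Real.exp_add]; ring
      _ = _ := by ring_nf

variable [FiniteDimensional ℝ E]

/-- The Taylor remainder `exp z - 1 - z` at `z = q B a` is at most `|z|² exp |z|`. For `‖B‖ ≤ ε / 2`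
this is bounded by `‖B‖²` times a constant times `exp (ε w)`, so the remainder in `L²` is `O(‖B‖²)`
against the single square integrable function `G`. -/
theorem hasFDerivAt_toL2_expFun (hq : ∀ B a, ‖q B a‖ ≤ ‖B‖ * w a)
    (hqm : ∀ B, AEStronglyMeasurable (q B) ν) (hw : ∀ a, 0 ≤ w a) (hwm : Measurable w)
    (hP : AEStronglyMeasurable P ν) (h : ExpDom ν q w P A) :
    ∃ D : E →L[ℝ] Lp ℂ 2 ν, (∀ B, D B = toL2 ν (expFun q (P * q B) A)) ∧
      HasFDerivAt (fun A => toL2 ν (expFun q P A)) D A := by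
  have hm : ∀ B, MemLp (expFun q (P * q B) A) 2 ν := fun B =>
    memLp_expFun hqm hw (hP.mul (hqm B)) (h.mul_phase hq hqm hwm hP B)
  let D : E →ₗ[ℝ] Lp ℂ 2 ν :=
    { toFun := fun B => toL2 ν (expFun q (P * q B) A)
      map_add' := fun B B' => by
        rw [← toL2_add (hm B) (hm B')]
        congr 1; ext a; simp [expFun]; ring
      map_smul' := fun c B => by
        rw [RingHom.id_apply, ← toL2_smul c (hm B)]
        congr 1; ext a; simp [expFun]; ring }
  refine ⟨D.toContinuousLinearMap, fun B => rfl, ?_⟩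
  have hopen := (isOpen_expDom hq hqm hw hwm hP).mem_nhds h
  obtain ⟨ε, hε, hG⟩ := h
  set G := hG.toLp with hGdef
  rw [hasFDerivAt_iff_isLittleO_nhds_zero]
  refine IsBigO.trans_isLittleO (g := fun B : E => ‖B‖ ^ 2) ?_
    (isLittleO_norm_pow_id one_lt_two)
  refine IsBigO.of_bound (8 / ε ^ 2 * ‖G‖) ?_
  have hnear : ∀ᶠ B : E in 𝓝 0, ExpDom ν q w P (A + B) := by
    have : Tendsto (fun B : E => A + B) (𝓝 0) (𝓝 A) := by
      simpa using (show Continuous fun B : E => A + B by fun_prop).tendsto 0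
    exact this.eventually hopen
  filter_upwards [hnear, Metric.ball_mem_nhds (0 : E) (half_pos hε)] with B hB hBε
  have hBε : ‖B‖ ≤ ε / 2 := (mem_ball_zero_iff.1 hBε).le
  have hA : MemLp (expFun q P A) 2 ν := memLp_expFun hqm hw hP ⟨ε, hε, hG⟩
  have hAB : MemLp (expFun q P (A + B)) 2 ν := memLp_expFun hqm hw hP hB
  rw [norm_pow, norm_norm]
  refine (Lp.norm_le_mul_norm_of_ae_le_mul (g := G) (c := 8 / ε ^ 2 * ‖B‖ ^ 2) ?_).trans
    (le_of_eq (by ring))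
  change ∀ᵐ a ∂ν, ‖(toL2 ν (expFun q P (A + B)) - toL2 ν (expFun q P A) -
    toL2 ν (expFun q (P * q B) A) : Lp ℂ 2 ν) a‖ ≤ _
  filter_upwards [Lp.coeFn_sub (toL2 ν (expFun q P (A + B)) - toL2 ν (expFun q P A))
    (toL2 ν (expFun q (P * q B) A)),
    Lp.coeFn_sub (toL2 ν (expFun q P (A + B))) (toL2 ν (expFun q P A)),
    coeFn_toL2 hAB, coeFn_toL2 hA, coeFn_toL2 (hm B), hG.coeFn_toLp] with a h1 h2 h3 h4 h5 h6
  rw [h1, Pi.sub_apply, h2, Pi.sub_apply, h3, h4, h5, h6]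
  have e : expFun q P (A + B) a - expFun q P A a - expFun q (P * q B) A a =
      expFun q P A a * (Complex.exp (q B a) - 1 - q B a) := by
    simp [expFun, Complex.exp_add]; ring
  have h7 : ‖Complex.exp (q B a) - 1 - q B a‖ ≤ ‖q B a‖ ^ 2 * Real.exp ‖q B a‖ := by
    have := Complex.norm_exp_sub_sum_le_norm_mul_exp (q B a) 2
    simpa [Finset.sum_range_succ, sub_sub] using this
  have h8 : ‖q B a‖ ^ 2 ≤ ‖B‖ ^ 2 * (8 / ε ^ 2 * Real.exp (ε / 2 * w a)) := by
    calc ‖q B a‖ ^ 2 ≤ (‖B‖ * w a) ^ 2 := by gcongr; exact hq B a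
      _ = ‖B‖ ^ 2 * w a ^ 2 := by ring
      _ ≤ _ := by gcongr; exact sq_le_exp hε (hw a)
  have h9 : ‖q B a‖ ≤ ε / 2 * w a :=
    (hq B a).trans (mul_le_mul_of_nonneg_right hBε (hw a))
  rw [e, norm_mul, norm_mul, norm_norm, Real.norm_eq_abs, Real.abs_exp]
  calc ‖expFun q P A a‖ * ‖Complex.exp (q B a) - 1 - q B a‖
      ≤ ‖expFun q P A a‖ * (‖B‖ ^ 2 * (8 / ε ^ 2 * Real.exp (ε / 2 * w a)) *
        Real.exp (ε / 2 * w a)) := by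
        gcongr
        exact h7.trans (by gcongr)
    _ = 8 / ε ^ 2 * ‖B‖ ^ 2 * (Real.exp (ε / 2 * w a + ε / 2 * w a) * ‖expFun q P A a‖) := by
        rw [Real.exp_add]; ring
    _ = _ := by ring_nf

theorem contDiffOn_toL2_expFun (hq : ∀ B a, ‖q B a‖ ≤ ‖B‖ * w a)
    (hqm : ∀ B, AEStronglyMeasurable (q B) ν) (hw : ∀ a, 0 ≤ w a) (hwm : Measurable w)
    (hP : AEStronglyMeasurable P ν) {U : Set E} (hU : IsOpen U) (h : ∀ A ∈ U, ExpDom ν q w P A) :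
    ContDiffOn ℝ (⊤ : ℕ∞) (fun A => toL2 ν (expFun q P A)) U := by
  -- The prefactor is generalised because each differentiation replaces `P` by `P * q B`.
  have key : ∀ n : ℕ, ∀ P : α → ℂ, AEStronglyMeasurable P ν → (∀ A ∈ U, ExpDom ν q w P A) →
      ContDiffOn ℝ n (fun A => toL2 ν (expFun q P A)) U := by
    intro n
    induction n with
    | zero =>
      intro P hP h
      refine contDiffOn_zero.2 fun A hA => ?_
      obtain ⟨D, -, hD⟩ := hasFDerivAt_toL2_expFun hq hqm hw hwm hP (h A hA)
      exact hD.continuousAt.continuousWithinAt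
    | succ n ih =>
      intro P hP h
      push_cast
      refine (contDiffOn_succ_iff_fderiv_apply hU.uniqueDiffOn).2 ⟨fun A hA => ?_, by simp,
        fun B => ?_⟩
      · obtain ⟨D, -, hD⟩ := hasFDerivAt_toL2_expFun hq hqm hw hwm hP (h A hA)
        exact hD.differentiableAt.differentiableWithinAt
      · refine (ih (P * q B) (hP.mul (hqm B))
          fun A hA => (h A hA).mul_phase hq hqm hwm hP B).congr fun A hA => ?_
        obtain ⟨D, hDB, hD⟩ := hasFDerivAt_toL2_expFun hq hqm hw hwm hP (h A hA)
        rw [fderivWithin_of_isOpen hU hA, hD.fderiv, hDB]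
  exact contDiffOn_infty.2 fun n => key n P hP h

end ExponentialFamily

/-! ### Gaussian integrals -/

section Gaussian

open Filter Topology

variable {V : Type*} [NormedAddCommGroup V] [NormedSpace ℝ V] [FiniteDimensional ℝ V]

theorem LinearMap.BilinForm.continuous_uncurry_of_finiteDimensional (B : LinearMap.BilinForm ℝ V) :
    Continuous fun p : V × V => B p.1 p.2 := by
  have : Continuous fun p : V × V => B.toContinuousBilinearMap p.1 p.2 := by fun_prop
  exact this

theorem LinearMap.BilinForm.continuous_diag (B : LinearMap.BilinForm ℝ V) :
    Continuous fun v => B v v :=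
  B.continuous_uncurry_of_finiteDimensional.comp (by fun_prop : Continuous fun v : V => (v, v))

theorem LinearMap.BilinForm.exists_bound (B : LinearMap.BilinForm ℝ V) :
    ∃ C, 0 < C ∧ ∀ u v, |B u v| ≤ C * ‖u‖ * ‖v‖ := by
  refine ⟨‖B.toContinuousBilinearMap‖ + 1, by positivity, fun u v => ?_⟩
  refine (B.toContinuousBilinearMap.le_opNorm₂ u v).trans ?_
  gcongr
  linarith

theorem LinearMap.BilinForm.exists_coercive (B : LinearMap.BilinForm ℝ V)
    (hB : ∀ v, v ≠ 0 → 0 < B v v) : ∃ ε > 0, ∀ v, ε * ‖v‖ ^ 2 ≤ B v v := by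
  -- The constant is the minimum on the unit sphere, which is empty when `V` is trivial.
  rcases (Metric.sphere (0 : V) 1).eq_empty_or_nonempty with he | hne
  · refine ⟨1, one_pos, fun v => ?_⟩
    have : v = 0 := by
      by_contra hv
      have : ‖v‖⁻¹ • v ∈ Metric.sphere (0 : V) 1 := by
        simp [norm_smul, hv]
      simp [he] at this
    simp [this]
  · obtain ⟨x, hx, hmin⟩ := (isCompact_sphere (0 : V) 1).exists_isMinOn hne
      B.continuous_diag.continuousOn
    have hx0 : x ≠ 0 := by
      rintro rfl
      simp at hx
    refine ⟨B x x, hB x hx0, fun v => ?_⟩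
    by_cases hv : v = 0
    · simp [hv]
    have hv' : ‖v‖ ≠ 0 := by simpa using hv
    have h1 : ‖v‖⁻¹ • v ∈ Metric.sphere (0 : V) 1 := by
      simp [norm_smul, hv]
    have h2 : B x x ≤ B (‖v‖⁻¹ • v) (‖v‖⁻¹ • v) := hmin h1
    simp only [map_smul, LinearMap.smul_apply, smul_eq_mul] at h2
    calc B x x * ‖v‖ ^ 2 ≤ ‖v‖⁻¹ * (‖v‖⁻¹ * B v v) * ‖v‖ ^ 2 := by gcongr
      _ = B v v := by field_simp

theorem one_add_pow_mul_exp_le (m : ℕ) {ε : ℝ} (hε : 0 < ε) :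
    ∃ C, 0 < C ∧ ∀ x : ℝ, 0 ≤ x → (1 + x) ^ m * Real.exp (-(ε * x ^ 2)) ≤ C := by
  -- The constant combines `t ^ m ≤ m! exp t` at `t = 1 + x` with `x - ε x² ≤ 1 / (4 ε)`, obtained
  -- by completing the square.
  refine ⟨m.factorial * Real.exp (1 + 1 / (4 * ε)), by positivity, fun x hx => ?_⟩
  have h := Real.pow_div_factorial_le_exp (1 + x) (by positivity) m
  rw [div_le_iff₀ (by positivity)] at h
  have h2 : 1 + x - ε * x ^ 2 ≤ 1 + 1 / (4 * ε) := by
    have : 1 / (4 * ε) - x + ε * x ^ 2 = ε * (x - 1 / (2 * ε)) ^ 2 := by field_simp; ring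
    nlinarith [mul_nonneg hε.le (sq_nonneg (x - 1 / (2 * ε)))]
  calc (1 + x) ^ m * Real.exp (-(ε * x ^ 2))
      ≤ Real.exp (1 + x) * m.factorial * Real.exp (-(ε * x ^ 2)) := by gcongr
    _ = m.factorial * Real.exp (1 + x - ε * x ^ 2) := by
      rw [sub_eq_add_neg (1 + x), Real.exp_add (1 + x)]; ring
    _ ≤ _ := by gcongr

variable [MeasurableSpace V] [BorelSpace V] (μ : Measure V) [μ.IsAddHaarMeasure]

theorem integrable_mul_exp_neg_of_coercive {F : Type*} [NormedAddCommGroup F]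
    {f : V → F} (hf : Continuous f) {b : V → ℝ} {C ε : ℝ} (hε : 0 < ε)
    (h : ∀ v, ‖f v‖ ≤ C * (1 + ‖v‖) ^ 2 * Real.exp (-b v))
    (hb : ∀ v, ε * ‖v‖ ^ 2 ≤ b v) : Integrable f μ := by
  set n := Module.finrank ℝ V
  -- The exponent is the `n + 1` needed for integrability in dimension `n`, plus `2` for the
  -- polynomial factor in `h`.
  obtain ⟨C', hC', hb'⟩ := one_add_pow_mul_exp_le (n + 3) hε
  have hC : 0 ≤ C := by
    have := (norm_nonneg _).trans (h 0)
    have h2 : 0 < Real.exp (-b 0) := Real.exp_pos _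
    simp only [norm_zero, add_zero, one_pow, mul_one] at this
    exact nonneg_of_mul_nonneg_left this h2
  have h0 : Integrable (fun v : V => (1 + ‖v‖) ^ (-((n : ℝ) + 1))) μ :=
    integrable_one_add_norm (by linarith)
  refine (h0.const_mul (C * C')).mono' hf.aestronglyMeasurable
    (Eventually.of_forall fun v => (h v).trans ?_)
  have hp : (1 + ‖v‖) ^ (-((n : ℝ) + 1)) = ((1 + ‖v‖) ^ (n + 1))⁻¹ := by
    rw [Real.rpow_neg (by positivity), ← Real.rpow_natCast]
    push_cast; rfl
  rw [hp, ← div_eq_mul_inv, le_div_iff₀ (by positivity)]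
  calc C * (1 + ‖v‖) ^ 2 * Real.exp (-b v) * (1 + ‖v‖) ^ (n + 1)
      = C * ((1 + ‖v‖) ^ (n + 3) * Real.exp (-b v)) := by ring
    _ ≤ C * ((1 + ‖v‖) ^ (n + 3) * Real.exp (-(ε * ‖v‖ ^ 2))) := by gcongr; exact hb v
    _ ≤ C * C' := by gcongr; exact hb' _ (norm_nonneg _)

theorem integrable_bilin_mul_exp_neg {B : LinearMap.BilinForm ℝ V}
    (hB : ∀ v, v ≠ 0 → 0 < B v v) (D : LinearMap.BilinForm ℝ V) :
    Integrable (fun v => D v v * Real.exp (-(B v v))) μ := by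
  obtain ⟨ε, hε, hεB⟩ := B.exists_coercive hB
  obtain ⟨C, hC, hD⟩ := D.exists_bound
  refine integrable_mul_exp_neg_of_coercive μ
    (D.continuous_diag.mul (Real.continuous_exp.comp B.continuous_diag.neg)) (C := C) hε
    (fun v => ?_) hεB
  rw [norm_mul, Real.norm_eq_abs, Real.norm_eq_abs, Real.abs_exp]
  have h1 : ‖v‖ ≤ 1 + ‖v‖ := by linarith
  gcongr
  calc |D v v| ≤ C * ‖v‖ * ‖v‖ := hD v v
    _ ≤ C * (1 + ‖v‖) * (1 + ‖v‖) := by gcongr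
    _ = _ := by ring

theorem integrable_exp_neg {B : LinearMap.BilinForm ℝ V}
    (hB : ∀ v, v ≠ 0 → 0 < B v v) : Integrable (fun v => Real.exp (-(B v v))) μ := by
  obtain ⟨ε, hε, hεB⟩ := B.exists_coercive hB
  refine integrable_mul_exp_neg_of_coercive μ
    (Real.continuous_exp.comp B.continuous_diag.neg) (C := 1) hε (fun v => ?_) hεB
  rw [Real.norm_eq_abs, Real.abs_exp]
  refine le_mul_of_one_le_left (Real.exp_pos _).le ?_
  rw [one_mul]
  exact one_le_pow₀ (by linarith [norm_nonneg v])

theorem integral_exp_neg_pos {B : LinearMap.BilinForm ℝ V}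
    (hB : ∀ v, v ≠ 0 → 0 < B v v) : 0 < ∫ v, Real.exp (-(B v v)) ∂μ :=
  integral_exp_pos (integrable_exp_neg μ hB)

/-- Integration by parts against a Gaussian. -/
theorem integral_linear_mul_bilin_mul_exp_neg {B : LinearMap.BilinForm ℝ V}
    (hB : ∀ v, v ≠ 0 → 0 < B v v) (hs : ∀ u v, B u v = B v u) (l : V →L[ℝ] ℝ) (u : V) :
    ∫ v, l v * B v u * Real.exp (-(B v v)) ∂μ = 1 / 2 * l u * ∫ v, Real.exp (-(B v v)) ∂μ := by
  have hg : ∀ v, HasFDerivAt (fun v => Real.exp (-(B v v)))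
      (Real.exp (-(B v v)) • (-((2 : ℝ) • B.toContinuousBilinearMap v))) v := fun v => by
    have h1 : HasFDerivAt (fun v => B.toContinuousBilinearMap v v)
        (B.toContinuousBilinearMap.precompR V v (ContinuousLinearMap.id ℝ V) +
          B.toContinuousBilinearMap.precompL V (ContinuousLinearMap.id ℝ V) v) v :=
      B.toContinuousBilinearMap.hasFDerivAt_of_bilinear (hasFDerivAt_id v) (hasFDerivAt_id v)
    have h2 := h1.neg.exp
    refine h2.congr_fderiv ?_
    ext x
    simp [two_mul, hs x v]
    ring
  have i1 := integrable_exp_neg μ hB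
  have i2 : Integrable (fun v => l v * B v u * Real.exp (-(B v v))) μ := by
    have := integrable_bilin_mul_exp_neg μ hB (LinearMap.mk₂ ℝ (fun x y => l x * B y u)
      (by intros; simp; ring) (by intros; simp; ring) (by intros; simp; ring)
      (by intros; simp; ring))
    simpa using this
  have i3 : Integrable (fun v => l v * Real.exp (-(B v v))) μ := by
    obtain ⟨ε, hε, hεB⟩ := B.exists_coercive hB
    refine integrable_mul_exp_neg_of_coercive μ
      (l.continuous.mul (Real.continuous_exp.comp B.continuous_diag.neg)) (C := ‖l‖) hε
      (fun v => ?_) hεB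
    rw [norm_mul, Real.norm_eq_abs (Real.exp _), Real.abs_exp]
    gcongr
    refine (l.le_opNorm v).trans ?_
    gcongr
    nlinarith [norm_nonneg v]
  -- The derivative of the Gaussian along `u` is `-2 B(v, u)` times the Gaussian, whence the factor
  -- `1 / 2`.
  have key := integral_mul_fderiv_eq_neg_fderiv_mul_of_integrable (μ := μ) (f := fun v => l v)
    (g := fun v => Real.exp (-(B v v))) (v := u)
    (by simpa using i1.const_mul (l u))
    (by
      simp only [(hg _).fderiv]
      refine (i2.const_mul (-2)).congr (Eventually.of_forall fun v => ?_)
      simp; ring)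
    i3 (fun v _ => l.differentiableAt) (fun v _ => (hg v).differentiableAt)
  simp only [(hg _).fderiv, ContinuousLinearMap.fderiv, integral_const_mul] at key
  have e : ∀ v, l v * (Real.exp (-(B v v)) • -((2 : ℝ) • B.toContinuousBilinearMap v)) u =
      -2 * (l v * B v u * Real.exp (-(B v v))) := fun v => by simp; ring
  simp only [e, integral_const_mul] at key
  linarith

/-- The second moments of a Gaussian. -/
theorem integral_bilin_comp_mul_exp_neg {B : LinearMap.BilinForm ℝ V}
    (hB : ∀ v, v ≠ 0 → 0 < B v v) (hs : ∀ u v, B u v = B v u) (C : V →ₗ[ℝ] V) :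
    ∫ v, B v (C v) * Real.exp (-(B v v)) ∂μ =
      1 / 2 * LinearMap.trace ℝ V C * ∫ v, Real.exp (-(B v v)) ∂μ := by
  let b := Module.finBasis ℝ V
  -- Expanding `C v` in a basis leaves one linear form times `B v (C (b i))` per term; integration
  -- by parts turns it into the diagonal entry of `C`.
  have e : ∀ v, B v (C v) * Real.exp (-(B v v)) =
      ∑ i, (b.coord i).toContinuousLinearMap v * B v (C (b i)) * Real.exp (-(B v v)) := fun v => by
    have h : C v = ∑ i, b.repr v i • C (b i) := by
      conv_lhs => rw [← b.sum_repr v]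
      simp only [map_sum, map_smul]
    rw [← Finset.sum_mul, h]
    simp
  simp only [e]
  rw [integral_finsetSum]
  · simp only [integral_linear_mul_bilin_mul_exp_neg μ hB hs]
    rw [← Finset.sum_mul, ← Finset.mul_sum, LinearMap.trace_eq_matrix_trace ℝ b, Matrix.trace]
    simp [LinearMap.toMatrix_apply]
  · intro i _
    have := integrable_bilin_mul_exp_neg μ hB (LinearMap.mk₂ ℝ
      (fun x y => b.coord i x * B y (C (b i)))
      (by intros; simp; ring) (by intros; simp; ring) (by intros; simp; ring)
      (by intros; simp; ring))
    simpa using this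

end Gaussian

/-! ### Partial derivatives -/

section PartialDerivatives

open Filter Topology

variable {k : ℕ} {E F : Type*} [NormedAddCommGroup E] [NormedSpace ℝ E]
  [NormedAddCommGroup F] [NormedSpace ℝ F]
  {𝔸 : Type*} [NormedRing 𝔸] [NormedAlgebra ℝ 𝔸]

theorem pd_congr {i : Fin k} {f g : (Fin k → ℝ) → E} {p : Fin k → ℝ} (h : f =ᶠ[𝓝 p] g) :
    pd i f p = pd i g p := by
  rw [pd, pd, h.fderiv_eq]

theorem pd_add {i : Fin k} {f g : (Fin k → ℝ) → E} {p : Fin k → ℝ}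
    (hf : DifferentiableAt ℝ f p) (hg : DifferentiableAt ℝ g p) :
    pd i (fun q => f q + g q) p = pd i f p + pd i g p := by
  simp [pd, fderiv_fun_add hf hg]

theorem pd_mul {i : Fin k} {f g : (Fin k → ℝ) → 𝔸} {p : Fin k → ℝ}
    (hf : DifferentiableAt ℝ f p) (hg : DifferentiableAt ℝ g p) :
    pd i (fun q => f q * g q) p = pd i f p * g p + f p * pd i g p := by
  simp [pd, fderiv_fun_mul' hf hg, add_comm]

theorem pd_smul {i : Fin k} [NormedSpace ℂ E] {f : (Fin k → ℝ) → ℂ} {g : (Fin k → ℝ) → E}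
    {p : Fin k → ℝ} (hf : DifferentiableAt ℝ f p) (hg : DifferentiableAt ℝ g p) :
    pd i (fun q => f q • g q) p = pd i f p • g p + f p • pd i g p := by
  simp [pd, fderiv_fun_smul hf hg, add_comm]

theorem pd_comp {i : Fin k} {S : E → F} {f : (Fin k → ℝ) → E} {p : Fin k → ℝ}
    (hS : DifferentiableAt ℝ S (f p)) (hf : DifferentiableAt ℝ f p) :
    pd i (fun q => S (f q)) p = fderiv ℝ S (f p) (pd i f p) := by
  have h : HasFDerivAt (fun q => S (f q)) (fderiv ℝ S (f p) ∘L fderiv ℝ f p) p :=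
    hS.hasFDerivAt.comp p hf.hasFDerivAt
  simp [pd, h.fderiv]

theorem pd_clm {i : Fin k} (L : E →L[ℝ] F) {f : (Fin k → ℝ) → E} {p : Fin k → ℝ}
    (hf : DifferentiableAt ℝ f p) : pd i (fun q => L (f q)) p = L (pd i f p) := by
  rw [pd_comp L.differentiableAt hf, L.fderiv]

theorem ContDiffAt.pd {i : Fin k} {f : (Fin k → ℝ) → E} {p : Fin k → ℝ}
    (hf : ContDiffAt ℝ (⊤ : ℕ∞) f p) : ContDiffAt ℝ (⊤ : ℕ∞) (pd i f) p :=
  (hf.fderiv_right (m := (⊤ : ℕ∞)) (by simp)).clm_apply contDiffAt_const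

theorem pd_comm {i j : Fin k} {f : (Fin k → ℝ) → E} {p : Fin k → ℝ}
    (hf : ContDiffAt ℝ (⊤ : ℕ∞) f p) : pd i (pd j f) p = pd j (pd i f) p := by
  have h1 : DifferentiableAt ℝ (fderiv ℝ f) p :=
    (hf.fderiv_right (m := (⊤ : ℕ∞)) (by simp)).differentiableAt (by simp)
  have h2 : ∀ i j : Fin k, _root_.pd i (_root_.pd j f) p =
      fderiv ℝ (fderiv ℝ f) p (Pi.single i 1) (Pi.single j 1) := fun i j => by
    have : HasFDerivAt (_root_.pd j f) _ p := h1.hasFDerivAt.clm_apply (hasFDerivAt_const _ p)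
    rw [_root_.pd, this.fderiv]
    simp
  rw [h2, h2]
  exact hf.isSymmSndFDerivAt (by
    rw [minSmoothness_of_isRCLikeNormedField]
    exact WithTop.coe_le_coe.2 (le_top (a := (2 : ℕ∞)))) _ _

end PartialDerivatives

/-! ### The trace on the algebra of operators -/

section OpTrace

variable {V : Type*} [NormedAddCommGroup V] [NormedSpace ℝ V]

/-- The trace as a linear form on continuous operators. -/
def opTraceₗ : (V →L[ℝ] V) →ₗ[ℝ] ℝ :=
  LinearMap.trace ℝ V ∘ₗ ContinuousLinearMap.coeLM ℝ

variable [FiniteDimensional ℝ V]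

/-- The trace as a continuous linear form on continuous operators. -/
def opTrace : (V →L[ℝ] V) →L[ℝ] ℝ := LinearMap.toContinuousLinearMap opTraceₗ

theorem opTrace_apply (X : V →L[ℝ] V) : opTrace X = LinearMap.trace ℝ V X.toLinearMap := rfl

theorem opTrace_mul_comm (X Y : V →L[ℝ] V) : opTrace (X * Y) = opTrace (Y * X) :=
  LinearMap.trace_mul_comm ℝ X.toLinearMap Y.toLinearMap

/-- Anticommutation gives `J W J = W`, while cyclicity gives `tr(J W J) = -tr W`. -/
theorem opTrace_eq_zero_of_anticommute {J W : V →L[ℝ] V} (hJ : J * J = -1)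
    (h : J * W = -(W * J)) : opTrace W = 0 := by
  have e : J * W * J = W := by rw [h, neg_mul, mul_assoc, hJ]; simp
  have h1 : opTrace (J * W * J) = -opTrace W := by
    rw [opTrace_mul_comm, ← mul_assoc, hJ, neg_one_mul, map_neg]
  rw [e] at h1
  linarith

/-- A symmetric operator of a Euclidean space whose square is traceless vanishes. -/
theorem eq_zero_of_opTrace_mul_self {g : LinearMap.BilinForm ℝ V} (hs : ∀ u v, g u v = g v u)
    (hg : ∀ v, v ≠ 0 → 0 < g v v) {X : V →L[ℝ] V} (hX : ∀ u v, g (X u) v = g u (X v))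
    (h : opTrace (X * X) = 0) : X = 0 := by
  obtain ⟨b, hb⟩ := LinearMap.BilinForm.exists_orthogonal_basis (B := g)
    ⟨fun u v => by simp [hs u v]⟩
  have hb' : ∀ i j, i ≠ j → g (b i) (b j) = 0 := fun i j hij => hb hij
  have hpos : ∀ i, 0 < g (b i) (b i) := fun i => hg _ (b.ne_zero i)
  have hrepr : ∀ v i, b.repr v i = g (b i) v / g (b i) (b i) := fun v i => by
    rw [eq_div_iff (hpos i).ne']
    conv_rhs => rw [← b.sum_repr v]
    rw [map_sum, Finset.sum_eq_single i]
    · simp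
    · intro j _ hj
      simp [hb' i j hj.symm]
    · simp
  -- In an orthogonal basis the trace of `X²` is a sum of nonnegative terms, so each `X (b i)`
  -- vanishes.
  have htr : opTrace (X * X) = ∑ i, g (X (b i)) (X (b i)) / g (b i) (b i) := by
    rw [opTrace_apply, LinearMap.trace_eq_matrix_trace ℝ b, Matrix.trace]
    refine Finset.sum_congr rfl fun i _ => ?_
    rw [Matrix.diag_apply, LinearMap.toMatrix_apply, hrepr, hX]
    rfl
  have hnn : ∀ v, 0 ≤ g v v := fun v => by
    by_cases hv : v = 0
    · simp [hv]
    · exact (hg v hv).le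
  rw [htr, Finset.sum_eq_zero_iff_of_nonneg
    fun i _ => div_nonneg (hnn _) (hpos i).le] at h
  have h0 : X.toLinearMap = 0 := b.ext fun i => by
    have h1 := h i (Finset.mem_univ i)
    rw [div_eq_zero_iff, or_iff_left (hpos i).ne'] at h1
    by_contra hne
    exact (hg _ hne).ne' h1
  ext v
  exact LinearMap.congr_fun h0 v

end OpTrace

/-! ### The symplectic form on compatible complex structures -/

section CompatibleJ

open Filter Topology

variable {V : Type*} [NormedAddCommGroup V] [NormedSpace ℝ V]
  {ω : LinearMap.BilinForm ℝ V} {J J₀ X Y : V →L[ℝ] V}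

theorem mul_self_of_mem_compatibleJ (hJ : J ∈ compatibleJ ω) : J * J = -1 := by
  ext v
  exact hJ.1 v

theorem skew_of_mem_compatibleJ (hJ : J ∈ compatibleJ ω) (u v : V) : ω (J u) v = -ω u (J v) := by
  have := hJ.2.1 u (J v)
  rw [hJ.1, map_neg] at this
  linarith

theorem mul_eq_neg_of_mem_tangentJ (hX : X ∈ tangentJ ω J) : J * X = -(X * J) := by
  ext v
  exact eq_neg_of_add_eq_zero_left (hX.1 v)

/-- With `A = -1/2 X J` and `B = -1/2 Y J`, the product `A J B` collapses by `J² = -1`. Later trace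
computations use this form. -/
theorem sympForm_eq [FiniteDimensional ℝ V] (hJ : J * J = -1) (X Y : V →L[ℝ] V) :
    sympForm J X Y = -(1 / 4) * opTrace (X * Y * J) := by
  have e : (pPart J X ∘L J ∘L pPart J Y : V →L[ℝ] V) = (-(1 / 4 : ℝ)) • (X * Y * J) := by
    have hJ' : ∀ v, J (J v) = -v := fun v => DFunLike.congr_fun hJ v
    ext v
    simp only [pPart, ContinuousLinearMap.comp_apply, neg_apply,
      smul_apply, map_neg, map_smul, hJ', smul_smul, smul_neg, neg_neg,
      mul_apply_eq_comp, neg_smul]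
    norm_num
  change opTrace (pPart J X ∘L J ∘L pPart J Y) = _
  rw [e, map_smul, smul_eq_mul]

theorem sympForm_self [FiniteDimensional ℝ V] (hJ : J ∈ compatibleJ ω) (hX : X ∈ tangentJ ω J) :
    sympForm J X X = 0 := by
  have hJJ := mul_self_of_mem_compatibleJ hJ
  have h := mul_eq_neg_of_mem_tangentJ hX
  have e : opTrace (X * X * J) = -opTrace (X * X * J) := by
    calc opTrace (X * X * J) = opTrace (X * (X * J)) := by rw [mul_assoc]
      _ = opTrace (X * -(J * X)) := by rw [h, neg_neg]
      _ = -opTrace (X * J * X) := by rw [mul_neg, map_neg, mul_assoc]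
      _ = -opTrace (X * X * J) := by rw [opTrace_mul_comm, mul_assoc X X J]
  rw [sympForm_eq hJJ]
  linarith

theorem mul_mem_tangentJ (hJ : J ∈ compatibleJ ω) (hX : X ∈ tangentJ ω J) :
    X * J ∈ tangentJ ω J := by
  have h : ∀ v, J (X v) = -X (J v) := fun v => eq_neg_of_add_eq_zero_left (hX.1 v)
  refine ⟨fun v => ?_, fun u v => ?_⟩
  · simp [h, hJ.1]
  · have h1 := hX.2 (J u) v
    have h3 := hJ.2.1 u (X v)
    rw [hJ.1, map_neg, LinearMap.neg_apply] at h1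
    rw [h, map_neg] at h3
    change ω (X (J u)) (J v) + ω (J u) (X (J v)) = 0
    linarith

/-- The test vector is `X J`: `Ω(X, X J) = 1/4 tr(X²)`, and `X` is symmetric for the inner product
`ω(·, J ·)`. -/
theorem eq_zero_of_sympForm_eq_zero [FiniteDimensional ℝ V] (hω : ω.IsAlt) (hJ : J ∈ compatibleJ ω)
    (hX : X ∈ tangentJ ω J) (h : ∀ Y ∈ tangentJ ω J, sympForm J X Y = 0) : X = 0 := by
  have hJJ := mul_self_of_mem_compatibleJ hJ
  have h1 := h _ (mul_mem_tangentJ hJ hX)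
  rw [sympForm_eq hJJ, ← mul_assoc, mul_assoc (X * X), hJJ] at h1
  have hskew : ∀ u v, ω u v = -ω v u := fun u v => (hω.neg_eq v u).symm ▸ rfl
  refine eq_zero_of_opTrace_mul_self (g := ω.compl₂ J.toLinearMap) (fun u v => ?_) hJ.2.2
    (fun u v => ?_) (by simpa using h1)
  · have := skew_of_mem_compatibleJ hJ v u
    have h2 := hskew (J v) u
    simp only [LinearMap.compl₂_apply, ContinuousLinearMap.coe_coe]
    linarith
  · have h2 := hX.2 u v
    have h3 := skew_of_mem_compatibleJ hJ u (X v)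
    simp only [LinearMap.compl₂_apply, ContinuousLinearMap.coe_coe]
    linarith

theorem sympForm_conj (g : V ≃L[ℝ] V) (J X Y : V →L[ℝ] V) :
    sympForm ((g : V →L[ℝ] V) ∘L J ∘L (g.symm : V →L[ℝ] V))
      ((g : V →L[ℝ] V) ∘L X ∘L (g.symm : V →L[ℝ] V))
      ((g : V →L[ℝ] V) ∘L Y ∘L (g.symm : V →L[ℝ] V)) = sympForm J X Y := by
  have h := LinearMap.trace_conj' (pPart J X ∘L J ∘L pPart J Y : V →L[ℝ] V).toLinearMap
    g.toLinearEquiv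
  refine Eq.trans ?_ h
  change LinearMap.trace ℝ V _ = _
  congr 1
  ext v
  simp [pPart, LinearEquiv.conj_apply]

theorem pd_sympForm [FiniteDimensional ℝ V] {k : ℕ} {i j l : Fin k} {γ : (Fin k → ℝ) → (V →L[ℝ] V)}
    (hγ : ContDiff ℝ (⊤ : ℕ∞) γ) (hJ : ∀ p, γ p * γ p = -1) (p : Fin k → ℝ) :
    pd i (fun q => sympForm (γ q) (pd j γ q) (pd l γ q)) p = -(1 / 4) *
      (opTrace (pd i (pd j γ) p * pd l γ p * γ p) + opTrace (pd j γ p * pd i (pd l γ) p * γ p) +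
        opTrace (pd j γ p * pd l γ p * pd i γ p)) := by
  have d0 : DifferentiableAt ℝ γ p := hγ.contDiffAt.differentiableAt (by simp)
  have d1 : ∀ j, DifferentiableAt ℝ (pd j γ) p := fun j =>
    hγ.contDiffAt.pd.differentiableAt (by simp)
  have e : (fun q => sympForm (γ q) (pd j γ q) (pd l γ q)) = fun q =>
      ((-(1 / 4 : ℝ)) • opTrace) (pd j γ q * pd l γ q * γ q) := by
    ext q
    rw [sympForm_eq (hJ q)]
    rfl
  rw [e, pd_clm _ (f := fun q => pd j γ q * pd l γ q * γ q) (((d1 j).mul (d1 l)).mul d0),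
    pd_mul (f := fun q => pd j γ q * pd l γ q) ((d1 j).mul (d1 l)) d0, pd_mul (d1 j) (d1 l)]
  simp only [add_mul, map_add, smul_apply, smul_eq_mul]
  ring

theorem pd_anticommute {k : ℕ} {i : Fin k} {γ : (Fin k → ℝ) → (V →L[ℝ] V)} {p : Fin k → ℝ}
    (hγ : DifferentiableAt ℝ γ p) (hJ : ∀ᶠ q in 𝓝 p, γ q * γ q = -1) :
    γ p * pd i γ p = -(pd i γ p * γ p) := by
  have h1 : pd i (fun q => γ q * γ q) p = pd i (fun _ => (-1 : V →L[ℝ] V)) p := pd_congr hJ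
  rw [pd_mul hγ hγ] at h1
  rw [eq_neg_iff_add_eq_zero, add_comm, h1]
  simp [pd]

/-- In the cyclic sum the second derivatives cancel in pairs, by `c1` and the symmetry of mixed
partials. The remaining terms are traces of three tangent vectors, which vanish because a product of
three operators anticommuting with `J` again anticommutes with it. -/
theorem sympForm_closed [FiniteDimensional ℝ V] {γ : (Fin 3 → ℝ) → (V →L[ℝ] V)}
    (hγ : ContDiff ℝ (⊤ : ℕ∞) γ)
    (hJ : ∀ p, γ p * γ p = -1) (p : Fin 3 → ℝ) :
    pd 0 (fun q => sympForm (γ q) (pd 1 γ q) (pd 2 γ q)) p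
    + pd 1 (fun q => sympForm (γ q) (pd 2 γ q) (pd 0 γ q)) p
    + pd 2 (fun q => sympForm (γ q) (pd 0 γ q) (pd 1 γ q)) p = 0 := by
  have d0 : DifferentiableAt ℝ γ p := hγ.contDiffAt.differentiableAt (by simp)
  have a : ∀ i, γ p * pd i γ p = -(pd i γ p * γ p) := fun i =>
    pd_anticommute d0 (Eventually.of_forall hJ)
  have c1 : ∀ (S : V →L[ℝ] V) i, opTrace (pd i γ p * S * γ p) =
      -opTrace (S * pd i γ p * γ p) := fun S i => by
    rw [mul_assoc, opTrace_mul_comm, mul_assoc, a i, mul_neg, map_neg, mul_assoc]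
  have c2 : ∀ i j l, opTrace (pd i γ p * pd j γ p * pd l γ p) = 0 := fun i j l => by
    refine opTrace_eq_zero_of_anticommute (hJ p) ?_
    calc γ p * (pd i γ p * pd j γ p * pd l γ p)
        = (γ p * pd i γ p) * pd j γ p * pd l γ p := by simp only [mul_assoc]
      _ = -(pd i γ p * (γ p * pd j γ p) * pd l γ p) := by rw [a i]; simp only [mul_assoc, neg_mul]
      _ = pd i γ p * pd j γ p * (γ p * pd l γ p) := by
        rw [a j]; simp only [mul_assoc, neg_mul, mul_neg, neg_neg]
      _ = _ := by rw [a l]; simp only [mul_assoc, mul_neg]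
  rw [pd_sympForm hγ hJ, pd_sympForm hγ hJ, pd_sympForm hγ hJ, c2, c2, c2, c1, c1, c1,
    pd_comm (i := 1) (j := 0) hγ.contDiffAt, pd_comm (i := 2) (j := 0) hγ.contDiffAt,
    pd_comm (i := 2) (j := 1) hγ.contDiffAt]
  ring

theorem isInvariantSymplecticForm_sympForm [FiniteDimensional ℝ V] (hω : ω.IsAlt) :
    IsInvariantSymplecticForm ω sympForm :=
  ⟨fun _ hJ _ hX => sympForm_self hJ hX,
    fun _ hJ _ hX h => eq_zero_of_sympForm_eq_zero hω hJ hX h,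
    fun _ hγ hJ p => sympForm_closed hγ (fun q => mul_self_of_mem_compatibleJ (hJ q)) p,
    fun g _ J _ X _ Y _ => sympForm_conj g J X Y⟩

end CompatibleJ

/-! ### The inverse of the sum of two compatible complex structures -/

section SumInverse

variable {V : Type*} [NormedAddCommGroup V] [NormedSpace ℝ V]
  {ω : LinearMap.BilinForm ℝ V} {J J₀ : V →L[ℝ] V}

theorem LinearMap.BilinForm.IsAlt.swap (hω : ω.IsAlt) (u v : V) : ω u v = -ω v u :=
  (LinearMap.IsAlt.neg hω v u).symm

/-- The inverse of `J₀ + J`. -/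
def sumInv (J₀ J : V →L[ℝ] V) : V →L[ℝ] V := Ring.inverse (J₀ + J)

/-- The quadratic form `B(v, v) = -2 ω(v, K v)`; with `K = (J₀ + J)⁻¹` the density `exp (-B(v, v))`
is the square of the modulus of the ground state of `J`. -/
def sumInvForm (ω : LinearMap.BilinForm ℝ V) (K : V →L[ℝ] V) : LinearMap.BilinForm ℝ V :=
  (-2 : ℝ) • ω.compl₂ K.toLinearMap

theorem sumInvForm_apply (K : V →L[ℝ] V) (u v : V) : sumInvForm ω K u v = -2 * ω u (K v) := by
  simp [sumInvForm]

theorem isUnit_add_of_mem_compatibleJ [FiniteDimensional ℝ V] (hJ₀ : J₀ ∈ compatibleJ ω)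
    (hJ : J ∈ compatibleJ ω) : IsUnit (J₀ + J) := by
  have : CompleteSpace V := FiniteDimensional.complete ℝ V
  have hinj : Function.Injective (J₀ + J : V →L[ℝ] V).toLinearMap := by
    rw [← LinearMap.ker_eq_bot, LinearMap.ker_eq_bot']
    intro v hv
    by_contra h
    have h1 : ω v ((J₀ + J) v) = 0 := by
      rw [show (J₀ + J) v = 0 from hv, map_zero]
    rw [add_apply, map_add] at h1
    linarith [hJ₀.2.2 v h, hJ.2.2 v h]
  exact ContinuousLinearMap.isUnit_iff_bijective.2
    ⟨hinj, LinearMap.injective_iff_surjective.1 hinj⟩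

variable [FiniteDimensional ℝ V]

theorem add_mul_sumInv (hJ₀ : J₀ ∈ compatibleJ ω) (hJ : J ∈ compatibleJ ω) :
    (J₀ + J) * sumInv J₀ J = 1 :=
  Ring.mul_inverse_cancel _ (isUnit_add_of_mem_compatibleJ hJ₀ hJ)

theorem sumInv_mul_add (hJ₀ : J₀ ∈ compatibleJ ω) (hJ : J ∈ compatibleJ ω) :
    sumInv J₀ J * (J₀ + J) = 1 :=
  Ring.inverse_mul_cancel _ (isUnit_add_of_mem_compatibleJ hJ₀ hJ)

/-- Both `(J₀ + J) J₀` and `J (J₀ + J)` equal `J J₀ - 1`, so `J₀ + J` intertwines the two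
structures, and so does its inverse. -/
theorem mul_sumInv (hJ₀ : J₀ ∈ compatibleJ ω) (hJ : J ∈ compatibleJ ω) :
    J₀ * sumInv J₀ J = sumInv J₀ J * J := by
  have h : (J₀ + J) * J₀ = J * (J₀ + J) := by
    rw [add_mul, mul_add, mul_self_of_mem_compatibleJ hJ, mul_self_of_mem_compatibleJ hJ₀, add_comm]
  calc J₀ * sumInv J₀ J = sumInv J₀ J * (J₀ + J) * J₀ * sumInv J₀ J := by
        rw [sumInv_mul_add hJ₀ hJ, one_mul]
    _ = sumInv J₀ J * ((J₀ + J) * J₀) * sumInv J₀ J := by simp only [mul_assoc]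
    _ = sumInv J₀ J * (J * (J₀ + J)) * sumInv J₀ J := by rw [h]
    _ = sumInv J₀ J * J * ((J₀ + J) * sumInv J₀ J) := by simp only [mul_assoc]
    _ = _ := by rw [add_mul_sumInv hJ₀ hJ, mul_one]

theorem sumInv_mul (hJ₀ : J₀ ∈ compatibleJ ω) (hJ : J ∈ compatibleJ ω) :
    sumInv J₀ J * J₀ = J * sumInv J₀ J := by
  have h := mul_sumInv hJ hJ₀
  rw [sumInv, add_comm J J₀, ← sumInv] at h
  exact h.symm

theorem add_apply_sumInv (hJ₀ : J₀ ∈ compatibleJ ω) (hJ : J ∈ compatibleJ ω) (v : V) :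
    J₀ (sumInv J₀ J v) + J (sumInv J₀ J v) = v :=
  DFunLike.congr_fun (add_mul_sumInv hJ₀ hJ) v

/-- The sum `J₀ + J` is skew for `ω`, hence so is its inverse, and `ω(·, K ·)` is symmetric. -/
theorem sumInv_symm (hω : ω.IsAlt) (hJ₀ : J₀ ∈ compatibleJ ω) (hJ : J ∈ compatibleJ ω) (u v : V) :
    ω u (sumInv J₀ J v) = ω v (sumInv J₀ J u) := by
  set K := sumInv J₀ J
  have h1 : ω u (K v) = ω (J₀ (K u) + J (K u)) (K v) := by rw [add_apply_sumInv hJ₀ hJ]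
  have h2 : ω v (K u) = ω (J₀ (K v) + J (K v)) (K u) := by rw [add_apply_sumInv hJ₀ hJ]
  rw [h1, h2]
  simp only [map_add, LinearMap.add_apply, skew_of_mem_compatibleJ hJ, skew_of_mem_compatibleJ hJ₀]
  have h3 := skew_of_mem_compatibleJ hJ (K v) (K u)
  have h4 := skew_of_mem_compatibleJ hJ₀ (K v) (K u)
  have h5 := hω.swap (J (K v)) (K u)
  have h6 := hω.swap (J₀ (K v)) (K u)
  linarith

theorem sumInv_neg (hω : ω.IsAlt) (hJ₀ : J₀ ∈ compatibleJ ω) (hJ : J ∈ compatibleJ ω) {v : V}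
    (hv : v ≠ 0) : ω v (sumInv J₀ J v) < 0 := by
  set K := sumInv J₀ J
  have h1 : ω v (K v) = ω (J₀ (K v) + J (K v)) (K v) := by rw [add_apply_sumInv hJ₀ hJ]
  have h2 : K v ≠ 0 := fun h => hv (by rw [← add_apply_sumInv hJ₀ hJ v]; simp [K, h])
  rw [h1, hω.swap, map_add]
  linarith [hJ.2.2 _ h2, hJ₀.2.2 _ h2]

theorem hasFDerivAt_sumInv (hJ₀ : J₀ ∈ compatibleJ ω) (hJ : J ∈ compatibleJ ω) :
    ∃ D : (V →L[ℝ] V) →L[ℝ] (V →L[ℝ] V), HasFDerivAt (sumInv J₀) D J ∧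
      ∀ X, D X = -(sumInv J₀ J * X * sumInv J₀ J) := by
  have : CompleteSpace V := FiniteDimensional.complete ℝ V
  obtain ⟨u, hu⟩ := isUnit_add_of_mem_compatibleJ hJ₀ hJ
  have h := hasFDerivAt_ringInverse (𝕜 := ℝ) u
  rw [hu] at h
  have h2 := h.comp J ((hasFDerivAt_id J).const_add J₀)
  refine ⟨_, h2, fun X => ?_⟩
  have h3 : ((u⁻¹ : (V →L[ℝ] V)ˣ) : V →L[ℝ] V) = sumInv J₀ J := by
    rw [sumInv, ← hu, Ring.inverse_unit]
  rw [h3]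
  rfl

theorem isOpen_contDiffOn_sumInv (J₀ : V →L[ℝ] V) :
    IsOpen {J : V →L[ℝ] V | IsUnit (J₀ + J)} ∧
      ContDiffOn ℝ (⊤ : ℕ∞) (sumInv J₀) {J : V →L[ℝ] V | IsUnit (J₀ + J)} := by
  have : CompleteSpace V := FiniteDimensional.complete ℝ V
  refine ⟨Units.isOpen.preimage (by fun_prop : Continuous fun J : V →L[ℝ] V => J₀ + J),
    fun J ⟨u, hu⟩ => ContDiffAt.contDiffWithinAt ?_⟩
  have h := contDiffAt_ringInverse (𝕜 := ℝ) (n := (⊤ : ℕ∞)) u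
  rw [hu] at h
  exact h.comp J (contDiffAt_const.add contDiffAt_id)

/-- The trace identity behind the curvature formula. -/
theorem opTrace_sumInv_curvature (hJ₀ : J₀ ∈ compatibleJ ω) (hJ : J ∈ compatibleJ ω)
    {X Y : V →L[ℝ] V} (hX : J * X = -(X * J)) (hY : J * Y = -(Y * J)) :
    opTrace (J₀ * sumInv J₀ J * Y * sumInv J₀ J * X) -
      opTrace (J₀ * sumInv J₀ J * X * sumInv J₀ J * Y) = 2 * sympForm J X Y := by
  set K := sumInv J₀ J with hK
  have hJJ := mul_self_of_mem_compatibleJ hJ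
  have c1 : K * J₀ = J * K := sumInv_mul hJ₀ hJ
  have c2 : J₀ * K = K * J := mul_sumInv hJ₀ hJ
  have c3 : K * (J₀ + J) = 1 := sumInv_mul_add hJ₀ hJ
  have e1 : J₀ * K * X * K * Y = -(K * X * K * J₀ * Y) := by
    rw [c2, mul_assoc K J X, hX, mul_assoc _ K J₀, c1]
    simp only [mul_assoc, neg_mul, mul_neg]
  have e2 : opTrace (J₀ * K * Y * K * X) = opTrace (K * X * K * J * Y) := by
    have : J₀ * K * Y * K * X = (J₀ * K * Y) * (K * X) := by simp only [mul_assoc]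
    rw [this, opTrace_mul_comm, c2]
    simp only [mul_assoc]
  -- The two traces now differ only in `J₀` against `J`, and `K (J₀ + J) = 1` removes one factor
  -- `K`.
  have e3 : opTrace (J₀ * K * Y * K * X) - opTrace (J₀ * K * X * K * Y) =
      opTrace (K * X * Y) := by
    have : K * X * K * J₀ * Y + K * X * K * J * Y = K * X * Y := by
      rw [← add_mul, mul_assoc _ K J₀, mul_assoc _ K J, ← mul_add, ← mul_add, c3, mul_one]
    rw [e1, e2, ← this, map_add, map_neg]
    ring
  have hXY : X * Y = -(J * (X * Y) * J) := by
    have : J * (X * Y) = X * Y * J := by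
      rw [← mul_assoc, hX, neg_mul, mul_assoc, hY, mul_neg, neg_neg, mul_assoc]
    rw [this, mul_assoc, hJJ, mul_neg_one, neg_neg]
  -- Since `X Y` commutes with `J`, the trace of `K X Y` depends only on the average of `K` and `-J
  -- K J`, which `e5` shows to be `-J / 2`.
  have e4 : opTrace (K * X * Y) = -opTrace (J * K * J * (X * Y)) := by
    have : K * X * Y = -(K * J * (X * Y) * J) := by
      conv_lhs => rw [mul_assoc, hXY]
      simp only [mul_assoc, mul_neg]
    rw [this, map_neg, opTrace_mul_comm]
    simp only [mul_assoc]
  have e5 : K - J * K * J = -J := by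
    have h : K * ((J₀ + J) * J) = J := by rw [← mul_assoc, c3, one_mul]
    rw [add_mul, hJJ, mul_add, ← mul_assoc, c1, mul_neg_one] at h
    have h' : K - J * K * J = -(J * K * J + -K) := by abel
    rw [h', h]
  have e6 : opTrace (K * X * Y) - opTrace (J * K * J * (X * Y)) = -opTrace (X * Y * J) := by
    rw [mul_assoc K, ← map_sub, ← sub_mul, e5, neg_mul, map_neg, opTrace_mul_comm]
  rw [e3, sympForm_eq hJJ]
  linarith

end SumInverse

/-! ### Ground states -/

section GroundStates

open Filter Topology

variable {V : Type*} [NormedAddCommGroup V] [NormedSpace ℝ V]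
  {ω : LinearMap.BilinForm ℝ V} {J J₀ : V →L[ℝ] V}

theorem hermForm_apply_right (hJ₀ : J₀ ∈ compatibleJ ω) (v w : V) :
    hermForm ω J₀ v (J₀ w) = -Complex.I * hermForm ω J₀ v w := by
  simp only [hermForm, hJ₀.1, map_neg, Complex.ofReal_neg]
  ring_nf
  simp only [Complex.I_sq]
  ring

theorem hermForm_apply_left (hJ₀ : J₀ ∈ compatibleJ ω) (v w : V) :
    hermForm ω J₀ (J₀ v) w = Complex.I * hermForm ω J₀ v w := by
  simp only [hermForm, skew_of_mem_compatibleJ hJ₀, hJ₀.1, map_neg, Complex.ofReal_neg]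
  ring_nf
  simp only [Complex.I_sq]
  ring

theorem hermForm_add_right (v w w' : V) :
    hermForm ω J₀ v (w + w') = hermForm ω J₀ v w + hermForm ω J₀ v w' := by
  simp only [hermForm, map_add, Complex.ofReal_add]
  ring

theorem hermForm_add_left (v v' w : V) :
    hermForm ω J₀ (v + v') w = hermForm ω J₀ v w + hermForm ω J₀ v' w := by
  simp only [hermForm, map_add, LinearMap.add_apply, Complex.ofReal_add]
  ring

theorem hermForm_smul_right (c : ℝ) (v w : V) :
    hermForm ω J₀ v (c • w) = c * hermForm ω J₀ v w := by
  simp only [hermForm, map_smul, smul_eq_mul, Complex.ofReal_mul]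
  ring

theorem hermForm_smul_left (c : ℝ) (v w : V) :
    hermForm ω J₀ (c • v) w = c * hermForm ω J₀ v w := by
  simp only [hermForm, map_smul, LinearMap.smul_apply, smul_eq_mul, Complex.ofReal_mul]
  ring

/-- The operator of `w` in the representation of the Heisenberg Lie algebra is
`h(·, w) - ∂_w`. -/
theorem dHeis_eq {f : V → ℂ} (hf : Differentiable ℝ f) (w v : V) :
    dHeis ω J₀ w f v = hermForm ω J₀ v w * f v - fderiv ℝ f v w := by
  have h1 : HasDerivAt (fun t : ℝ => f (v - t • w)) (-(fderiv ℝ f v w)) 0 := by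
    have a : HasDerivAt (fun t : ℝ => v - t • w) (-w) 0 := by
      simpa using ((hasDerivAt_id (0 : ℝ)).smul_const w).const_sub v
    have b : HasFDerivAt f (fderiv ℝ f v) (v - (0 : ℝ) • w) := by
      simpa using (hf v).hasFDerivAt
    exact (b.comp_hasDerivAt (0 : ℝ) a).congr_deriv (by simp)
  have h2 : HasDerivAt (fun t : ℝ => hermForm ω J₀ v (t • w) - hermForm ω J₀ (t • w) (t • w) / 2)
      (hermForm ω J₀ v w) 0 := by
    have t : HasDerivAt (fun t : ℝ => (t : ℂ)) 1 0 := (hasDerivAt_id (0 : ℝ)).ofReal_comp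
    have a := (t.mul_const (hermForm ω J₀ v w)).sub
      (((t.mul t).mul_const (hermForm ω J₀ w w)).div_const 2)
    refine (a.congr_deriv (by simp)).congr_of_eventuallyEq (Eventually.of_forall fun s => ?_)
    simp [hermForm_smul_left, hermForm_smul_right, mul_assoc]
  have h3 := (h2.cexp.mul h1).deriv
  rw [dHeis]
  refine h3.trans ?_
  simp [hermForm]
  ring

/-- The logarithmic derivative of the ground state of `J` (with `K = (J₀ + J)⁻¹`). -/
def logForm (ω : LinearMap.BilinForm ℝ V) (J₀ K : V →L[ℝ] V) (v u : V) : ℂ :=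
  hermForm ω J₀ v u + 2 * Complex.I * hermForm ω J₀ v (K u)

/-- The phase of the exponential family of ground states: its parameter is `K = (J₀ + J)⁻¹`. -/
def groundPhase (ω : LinearMap.BilinForm ℝ V) (J₀ : V →L[ℝ] V) : (V →L[ℝ] V) →ₗ[ℝ] V → ℂ where
  toFun K v := Complex.I * hermForm ω J₀ v (K v)
  map_add' K K' := by
    ext v
    simp [hermForm_add_right, mul_add]
  map_smul' c K := by
    ext v
    simp [hermForm_smul_right]
    ring

/-- The prefactor of the exponential family of ground states. -/
def groundPrefactor (ω : LinearMap.BilinForm ℝ V) (J₀ : V →L[ℝ] V) (v : V) : ℂ :=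
  Complex.exp ((1 / 2 * ω v (J₀ v) : ℝ) : ℂ)

/-- The left side is adapted to varying `K`, the right side to differentiating in `v`. -/
theorem expFun_ground (hω : ω.IsAlt) (K : V →L[ℝ] V) (v : V) :
    expFun (groundPhase ω J₀) (groundPrefactor ω J₀) K v =
      Complex.exp (logForm ω J₀ K v v / 2) := by
  have : ω v v = 0 := hω v
  rw [expFun, groundPrefactor, ← Complex.exp_add]
  congr 1
  simp [groundPhase, logForm, hermForm, this]
  ring

theorem norm_expFun_ground (K : V →L[ℝ] V) (v : V) :
    ‖expFun (groundPhase ω J₀) (groundPrefactor ω J₀) K v‖ =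
      Real.exp (1 / 2 * ω v (J₀ v) + ω v (K v)) := by
  rw [expFun, groundPrefactor, norm_mul, Complex.norm_exp, Complex.norm_exp, ← Real.exp_add]
  simp [groundPhase, hermForm]

variable [FiniteDimensional ℝ V]

theorem continuous_bilin_apply (ω : LinearMap.BilinForm ℝ V) (K : V →L[ℝ] V) :
    Continuous fun v => ω v (K v) :=
  ω.continuous_uncurry_of_finiteDimensional.comp (by fun_prop : Continuous fun v : V => (v, K v))

theorem continuous_groundPhase (K : V →L[ℝ] V) : Continuous (groundPhase ω J₀ K) := by
  have h1 := continuous_bilin_apply ω K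
  have h2 := continuous_bilin_apply ω (J₀ ∘L K)
  exact continuous_const.mul ((Complex.continuous_ofReal.comp h2).sub
    (continuous_const.mul (Complex.continuous_ofReal.comp h1)))

theorem continuous_groundPrefactor : Continuous (groundPrefactor ω J₀) :=
  Complex.continuous_exp.comp
    (Complex.continuous_ofReal.comp (continuous_const.mul (continuous_bilin_apply ω J₀)))

theorem exists_groundPhase_bound (ω : LinearMap.BilinForm ℝ V) (J₀ : V →L[ℝ] V) :
    ∃ C, 0 < C ∧ ∀ (B : V →L[ℝ] V) v, ‖groundPhase ω J₀ B v‖ ≤ ‖B‖ * (C * ‖v‖ ^ 2) := by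
  obtain ⟨C, hC, h⟩ := ω.exists_bound
  refine ⟨C * (‖J₀‖ + 1), by positivity, fun B v => ?_⟩
  have h1 : ‖groundPhase ω J₀ B v‖ ≤ |ω v (J₀ (B v))| + |ω v (B v)| := by
    change ‖Complex.I * ((ω v (J₀ (B v)) : ℂ) - Complex.I * (ω v (B v) : ℂ))‖ ≤ _
    rw [norm_mul, Complex.norm_I, one_mul]
    refine (norm_sub_le _ _).trans ?_
    simp
  calc ‖groundPhase ω J₀ B v‖ ≤ |ω v (J₀ (B v))| + |ω v (B v)| := h1
    _ ≤ C * ‖v‖ * ‖J₀ (B v)‖ + C * ‖v‖ * ‖B v‖ := add_le_add (h _ _) (h _ _)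
    _ ≤ C * ‖v‖ * (‖J₀‖ * (‖B‖ * ‖v‖)) + C * ‖v‖ * (‖B‖ * ‖v‖) := by
      gcongr
      · exact (J₀.le_opNorm _).trans (by gcongr; exact B.le_opNorm v)
      · exact B.le_opNorm v
    _ = _ := by ring

theorem ground_equation_iff (hJ₀ : J₀ ∈ compatibleJ ω) (hJ : J ∈ compatibleJ ω) {f : V → ℂ}
    (hf : IsHolo J₀ f) :
    (∀ ξ ∈ lagr J, ∀ v, dHeisC ω J₀ ξ f v = 0) ↔
      ∀ v u, fderiv ℝ f v u = logForm ω J₀ (sumInv J₀ J) v u * f v := by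
  set K := sumInv J₀ J with hK
  have hU : ∀ u, J₀ (K u) + J (K u) = u := add_apply_sumInv hJ₀ hJ
  have hlog : ∀ v u, logForm ω J₀ K v u =
      hermForm ω J₀ v (J (K u)) + Complex.I * hermForm ω J₀ v (K u) := fun v u => by
    have : hermForm ω J₀ v u = hermForm ω J₀ v (J₀ (K u) + J (K u)) := by rw [hU]
    rw [logForm, this, hermForm_add_right, hermForm_apply_right hJ₀]
    ring
  have hdf : ∀ v u, fderiv ℝ f v u =
      fderiv ℝ f v (J (K u)) + Complex.I * fderiv ℝ f v (K u) := fun v u => by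
    have : fderiv ℝ f v u = fderiv ℝ f v (J₀ (K u) + J (K u)) := by rw [hU]
    rw [this, map_add, hf.2, add_comm]
  -- Holomorphy turns `i ∂_{K u}` into `∂_{J₀ K u}`, so the two derivatives add up to `∂_u`.
  have hmain : ∀ v u, dHeisC ω J₀ (J (K u), K u) f v =
      logForm ω J₀ K v u * f v - fderiv ℝ f v u := fun v u => by
    rw [dHeisC, dHeis_eq hf.1, dHeis_eq hf.1, hlog, hdf v u]
    ring
  constructor
  · intro h v u
    have := h (J (K u), K u) ⟨hJ.1 _, rfl⟩ v
    rw [hmain] at this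
    exact (sub_eq_zero.1 this).symm
  · rintro h ⟨a, b⟩ ⟨h1, h2⟩ v
    dsimp only at h1 h2
    -- Every `(1,0)` vector `a + i b` arises from `u = (J₀ + J) b`.
    have hb : K ((J₀ + J) b) = b := DFunLike.congr_fun (sumInv_mul_add hJ₀ hJ) b
    have := hmain v ((J₀ + J) b)
    rw [hb, h2, ← h] at this
    rw [this, sub_self]

/-- This is the integrability condition of `df = λ f`. The real part is symmetric by symmetry of
`ω(·, J₀ ·)` and `ω(·, K ·)`. The imaginary part equals `ω(u, J₀ K v) + ω(v, J₀ K u)`, by `J₀ K + J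
K = 1` and `h2`. -/
theorem logForm_symm (hω : ω.IsAlt) (hJ₀ : J₀ ∈ compatibleJ ω) (hJ : J ∈ compatibleJ ω) (u v : V) :
    logForm ω J₀ (sumInv J₀ J) u v = logForm ω J₀ (sumInv J₀ J) v u := by
  set K := sumInv J₀ J with hK
  have hs : ∀ u v, ω u (K v) = ω v (K u) := sumInv_symm hω hJ₀ hJ
  have h1 : ω u (J₀ v) = ω v (J₀ u) := by
    rw [hω.swap, skew_of_mem_compatibleJ hJ₀, neg_neg]
  have h2 : ∀ u v, ω u (J₀ (K v)) = -ω v (J (K u)) := fun u v => by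
    have a := skew_of_mem_compatibleJ hJ₀ u (K v)
    have b : K (J₀ u) = J (K u) := DFunLike.congr_fun (sumInv_mul hJ₀ hJ) u
    rw [← b, ← hs]
    linarith
  have h3 : ∀ u v, ω u (J₀ (K v)) + ω u (J (K v)) = ω u v := fun u v => by
    rw [← map_add, add_apply_sumInv hJ₀ hJ]
  have h4 : -ω u v + 2 * ω u (J₀ (K v)) = -ω v u + 2 * ω v (J₀ (K u)) := by
    have a := h3 u v
    have b := h2 u v
    have c := h2 v u
    have d := h3 v u
    linarith
  have e : ∀ u v, logForm ω J₀ K u v =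
      ((ω u (J₀ v) + 2 * ω u (K v) : ℝ) : ℂ) +
        Complex.I * ((-ω u v + 2 * ω u (J₀ (K v)) : ℝ) : ℂ) := fun u v => by
    simp only [logForm, hermForm]
    push_cast
    ring_nf
    simp only [Complex.I_sq]
    ring
  rw [e, e, h4, h1, hs]

theorem hasFDerivAt_logForm_half (hω : ω.IsAlt) (hJ₀ : J₀ ∈ compatibleJ ω)
    (hJ : J ∈ compatibleJ ω) (v : V) :
    ∃ D : V →L[ℝ] ℂ, (∀ u, D u = logForm ω J₀ (sumInv J₀ J) v u) ∧
      HasFDerivAt (fun v => logForm ω J₀ (sumInv J₀ J) v v / 2) D v := by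
  let b : V →ₗ[ℝ] V →ₗ[ℝ] ℂ := LinearMap.mk₂ ℝ (logForm ω J₀ (sumInv J₀ J))
    (fun _ _ _ => by simp only [logForm, hermForm_add_left]; ring)
    (fun _ _ _ => by simp only [logForm, hermForm_smul_left, Complex.real_smul]; ring)
    (fun _ _ _ => by simp only [logForm, hermForm_add_right, map_add]; ring)
    (fun _ _ _ => by simp only [logForm, hermForm_smul_right, map_smul, Complex.real_smul]; ring)
  have h := (b.toContinuousBilinearMap.hasFDerivAt_of_bilinear (hasFDerivAt_id v)
    (hasFDerivAt_id v)).mul_const (2⁻¹ : ℂ)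
  refine ⟨_, fun u => ?_, h⟩
  have hs := logForm_symm hω hJ₀ hJ u v
  simp [b, hs]
  ring

theorem isHolo_ground (hω : ω.IsAlt) (hJ₀ : J₀ ∈ compatibleJ ω) (hJ : J ∈ compatibleJ ω) :
    IsHolo J₀ (expFun (groundPhase ω J₀) (groundPrefactor ω J₀) (sumInv J₀ J)) ∧
    ∀ v u, fderiv ℝ (expFun (groundPhase ω J₀) (groundPrefactor ω J₀) (sumInv J₀ J)) v u =
      logForm ω J₀ (sumInv J₀ J) v u *
        expFun (groundPhase ω J₀) (groundPrefactor ω J₀) (sumInv J₀ J) v := by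
  set f := expFun (groundPhase ω J₀) (groundPrefactor ω J₀) (sumInv J₀ J) with hf
  have e : f = fun v => Complex.exp (logForm ω J₀ (sumInv J₀ J) v v / 2) :=
    funext (expFun_ground hω _)
  have key : ∀ v, DifferentiableAt ℝ f v ∧
      ∀ u, fderiv ℝ f v u = logForm ω J₀ (sumInv J₀ J) v u * f v := fun v => by
    obtain ⟨D, hD, h⟩ := hasFDerivAt_logForm_half hω hJ₀ hJ v
    have h' := h.cexp
    rw [e]
    refine ⟨h'.differentiableAt, fun u => ?_⟩
    rw [h'.fderiv]
    simp [hD, mul_comm]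
  refine ⟨⟨fun v => (key v).1, fun v w => ?_⟩, fun v => (key v).2⟩
  rw [(key v).2, (key v).2, ← mul_assoc]
  congr 1
  -- Symmetry moves `J₀ w` into the first slot of `h`, which is complex linear.
  rw [logForm_symm hω hJ₀ hJ, logForm_symm hω hJ₀ hJ v w, logForm, logForm,
    hermForm_apply_left hJ₀, hermForm_apply_left hJ₀]
  ring

theorem eq_smul_ground (hω : ω.IsAlt) (hJ₀ : J₀ ∈ compatibleJ ω) (hJ : J ∈ compatibleJ ω)
    {f : V → ℂ} (hf : Differentiable ℝ f)
    (h : ∀ v u, fderiv ℝ f v u = logForm ω J₀ (sumInv J₀ J) v u * f v) (v : V) :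
    f v = f 0 * expFun (groundPhase ω J₀) (groundPrefactor ω J₀) (sumInv J₀ J) v := by
  rw [expFun_ground hω]
  -- The quotient of `f` by the Gaussian has zero derivative, hence is constant.
  have key : ∀ v, HasFDerivAt
      (fun v => f v * Complex.exp (-(logForm ω J₀ (sumInv J₀ J) v v / 2))) 0 v := fun v => by
    obtain ⟨D, hD, hd⟩ := hasFDerivAt_logForm_half hω hJ₀ hJ v
    refine ((hf v).hasFDerivAt.mul hd.fun_neg.cexp).congr_fderiv ?_
    ext u
    simp [h, hD]
    ring
  have := is_const_of_fderiv_eq_zero (fun v => (key v).differentiableAt)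
    (fun v => (key v).fderiv) v 0
  have h0 : logForm ω J₀ (sumInv J₀ J) 0 0 = 0 := by simp [logForm, hermForm]
  rw [h0] at this
  simp only [zero_div, neg_zero, Complex.exp_zero, mul_one] at this
  rw [← this, mul_assoc, ← Complex.exp_add]
  simp

end GroundStates

/-! ### Line bundles spanned by a smooth section -/

section SpannedLineBundle

open Filter Topology

variable {H : Type*} [NormedAddCommGroup H] [InnerProductSpace ℂ H]

theorem isSmoothLineBundle_of_section {X : Type*} [NormedAddCommGroup X] [NormedSpace ℝ X]
    {M O : Set X} {R : X → Submodule ℂ H} {S : X → H}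
    (hO : IsOpen O) (hMO : M ⊆ O) (hS : ContDiffOn ℝ (⊤ : ℕ∞) S O)
    (hne : ∀ J ∈ M, S J ≠ 0) (hR : ∀ J ∈ M, R J = Submodule.span ℂ {S J}) :
    IsSmoothLineBundle M R := by
  refine ⟨fun J hJ => ?_, fun J hJ => ⟨O, S, hO, hMO hJ, hS, fun J' hJ' => ⟨?_, hne J' hJ'.2⟩⟩⟩
  · rw [hR J hJ]
    exact finrank_span_singleton (hne J hJ)
  · rw [hR J' hJ'.2]
    exact Submodule.mem_span_singleton_self _

variable [CompleteSpace H] {X : Type*}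

theorem covD_eq_of_span {k : ℕ} {R : X → Submodule ℂ H} {γ : (Fin k → ℝ) → X} {i : Fin k}
    {φ : (Fin k → ℝ) → H} {p : Fin k → ℝ} {s : H} (hR : R (γ p) = Submodule.span ℂ {s}) :
    covD R γ i φ p = (inner ℂ s (pd i φ p) / inner ℂ s s) • s := by
  have h : (R (γ p)).topologicalClosure = Submodule.span ℂ {s} := by
    rw [hR]
    exact (Submodule.closed_of_finiteDimensional _).submodule_topologicalClosure_eq
  rw [covD]
  simp only [h]
  rw [Submodule.starProjection_singleton, inner_self_eq_norm_sq_to_K]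
  simp

/-- The covariant derivative of a multiple of a section with connection coefficient `a`. -/
theorem covD_smul_section {k : ℕ} {R : X → Submodule ℂ H} {γ : (Fin k → ℝ) → X} {i : Fin k}
    {φ s : (Fin k → ℝ) → H} {c : (Fin k → ℝ) → ℂ} {a : ℂ} {p : Fin k → ℝ}
    (hR : R (γ p) = Submodule.span ℂ {s p}) (hs : DifferentiableAt ℝ s p)
    (hc : DifferentiableAt ℝ c p) (hne : s p ≠ 0)
    (ha : inner ℂ (s p) (pd i s p) = a * inner ℂ (s p) (s p))
    (hφ : φ =ᶠ[𝓝 p] fun q => c q • s q) :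
    covD R γ i φ p = (pd i c p + c p * a) • s p := by
  have h0 : inner ℂ (s p) (s p) ≠ 0 := inner_self_ne_zero.2 hne
  rw [covD_eq_of_span hR, pd_congr hφ, pd_smul hc hs, inner_add_right, inner_smul_right,
    inner_smul_right, ha]
  congr 1
  field_simp

/-- The curvature of a line bundle spanned by a section with connection coefficients `a i`. -/
theorem covD_commutator {R : X → Submodule ℂ H} {γ : (Fin 2 → ℝ) → X} {U : Set (Fin 2 → ℝ)}
    (hU : IsOpen U) {ψ s : (Fin 2 → ℝ) → H} {a : Fin 2 → (Fin 2 → ℝ) → ℂ}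
    (hs : ContDiffOn ℝ (⊤ : ℕ∞) s U) (hψ : ContDiffOn ℝ (⊤ : ℕ∞) ψ U)
    (hne : ∀ p ∈ U, s p ≠ 0) (hR : ∀ p ∈ U, R (γ p) = Submodule.span ℂ {s p})
    (hψR : ∀ p ∈ U, ψ p ∈ R (γ p))
    (ha : ∀ i, ∀ p ∈ U, inner ℂ (s p) (pd i s p) = a i p * inner ℂ (s p) (s p))
    (had : ∀ i, ∀ p ∈ U, DifferentiableAt ℝ (a i) p) {p : Fin 2 → ℝ} (hp : p ∈ U) :
    covD R γ 0 (covD R γ 1 ψ) p - covD R γ 1 (covD R γ 0 ψ) p =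
      (pd 0 (a 1) p - pd 1 (a 0) p) • ψ p := by
  have hs' : ∀ q ∈ U, ContDiffAt ℝ (⊤ : ℕ∞) s q := fun q hq => hs.contDiffAt (hU.mem_nhds hq)
  have hψ' : ∀ q ∈ U, ContDiffAt ℝ (⊤ : ℕ∞) ψ q := fun q hq => hψ.contDiffAt (hU.mem_nhds hq)
  have h0 : ∀ q ∈ U, inner ℂ (s q) (s q) ≠ 0 := fun q hq => inner_self_ne_zero.2 (hne q hq)
  -- Defining the coefficient of `ψ` by inner products makes its smoothness evident.
  set c : (Fin 2 → ℝ) → ℂ := fun q => inner ℂ (s q) (ψ q) / inner ℂ (s q) (s q) with hcdef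
  have hc : ∀ q ∈ U, ContDiffAt ℝ (⊤ : ℕ∞) c q := fun q hq => by
    simp only [hcdef, div_eq_mul_inv]
    exact ((hs' q hq).inner ℂ (hψ' q hq)).mul (((hs' q hq).inner ℂ (hs' q hq)).inv (h0 q hq))
  have hcψ : ∀ q ∈ U, ψ q = c q • s q := fun q hq => by
    have h := hψR q hq
    rw [hR q hq, Submodule.mem_span_singleton] at h
    obtain ⟨t, ht⟩ := h
    have h1 := h0 q hq
    rw [hcdef]
    simp only [← ht, inner_smul_right]
    congr 1
    field_simp
  have hsd : ∀ q ∈ U, DifferentiableAt ℝ s q := fun q hq => (hs' q hq).differentiableAt (by simp)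
  have hcd : ∀ q ∈ U, DifferentiableAt ℝ c q := fun q hq => (hc q hq).differentiableAt (by simp)
  have hpd : ∀ i, ∀ q ∈ U, DifferentiableAt ℝ (pd i c) q := fun i q hq =>
    (hc q hq).pd.differentiableAt (by simp)
  have h1 : ∀ i, ∀ q ∈ U, covD R γ i ψ q = (pd i c q + c q * a i q) • s q := fun i q hq =>
    covD_smul_section (hR q hq) (hsd q hq) (hcd q hq) (hne q hq) (ha i q hq)
      (eventually_of_mem (hU.mem_nhds hq) hcψ)
  have h2 : ∀ i j, covD R γ i (covD R γ j ψ) p =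
      (pd i (pd j c) p + (pd i c p * a j p + c p * pd i (a j) p) +
        (pd j c p + c p * a j p) * a i p) • s p := fun i j => by
    rw [covD_smul_section (c := fun q => pd j c q + c q * a j q) (hR p hp) (hsd p hp)
      ((hpd j p hp).add ((hcd p hp).mul (had j p hp))) (hne p hp) (ha i p hp)
      (eventually_of_mem (hU.mem_nhds hp) (h1 j)),
      pd_add (g := fun q => c q * a j q) (hpd j p hp) ((hcd p hp).mul (had j p hp)),
      pd_mul (hcd p hp) (had j p hp)]
  -- The first-order terms in `c` and the products `a i * a j` are symmetric in the indices; only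
  -- the derivatives of the coefficients survive.
  rw [h2, h2, ← sub_smul, hcψ p hp, smul_smul, pd_comm (i := 1) (j := 0) (hc p hp)]
  congr 1
  ring

end SpannedLineBundle

/-! ### The ground states in the Bargmann space -/

section GroundVec

open Filter Topology

variable {V : Type*} [NormedAddCommGroup V] [NormedSpace ℝ V] [FiniteDimensional ℝ V]
  [MeasurableSpace V] [BorelSpace V] (μ : Measure V)
  {ω : LinearMap.BilinForm ℝ V} {J J₀ K : V →L[ℝ] V}

theorem measurable_gaussWeight (ω : LinearMap.BilinForm ℝ V) (J₀ : V →L[ℝ] V) :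
    Measurable fun v => ENNReal.ofReal (Real.exp (-(ω v (J₀ v)))) :=
  ENNReal.measurable_ofReal.comp
    (Real.continuous_exp.comp (continuous_bilin_apply ω J₀).neg).measurable

theorem integrable_gaussMeasure_iff {F : Type*} [NormedAddCommGroup F] [NormedSpace ℝ F]
    {f : V → F} : Integrable f (gaussMeasure μ ω J₀) ↔
      Integrable (fun v => Real.exp (-(ω v (J₀ v))) • f v) μ := by
  rw [gaussMeasure, integrable_withDensity_iff_integrable_smul' (measurable_gaussWeight ω J₀)
    (Eventually.of_forall fun _ => ENNReal.ofReal_lt_top)]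
  simp [ENNReal.toReal_ofReal (Real.exp_pos _).le]

theorem integral_gaussMeasure {F : Type*} [NormedAddCommGroup F] [NormedSpace ℝ F] (f : V → F) :
    ∫ v, f v ∂gaussMeasure μ ω J₀ = ∫ v, Real.exp (-(ω v (J₀ v))) • f v ∂μ := by
  rw [gaussMeasure, integral_withDensity_eq_integral_toReal_smul (measurable_gaussWeight ω J₀)
    (Eventually.of_forall fun _ => ENNReal.ofReal_lt_top)]
  simp [ENNReal.toReal_ofReal (Real.exp_pos _).le]

theorem expDom_ground [μ.IsAddHaarMeasure] {C : ℝ} (hC : 0 < C)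
    (hK : ∀ v, v ≠ 0 → ω v (K v) < 0) :
    ExpDom (gaussMeasure μ ω J₀) (groundPhase ω J₀) (fun v => C * ‖v‖ ^ 2)
      (groundPrefactor ω J₀) K := by
  obtain ⟨ε, hε, hεB⟩ := (sumInvForm ω K).exists_coercive fun v hv => by
    rw [sumInvForm_apply]
    linarith [hK v hv]
  have c1 : Continuous fun v : V => Real.exp (ε / (4 * C) * (C * ‖v‖ ^ 2)) *
      ‖expFun (groundPhase ω J₀) (groundPrefactor ω J₀) K v‖ := by
    have : Continuous (expFun (groundPhase ω J₀) (groundPrefactor ω J₀) K) :=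
      continuous_groundPrefactor.mul (Complex.continuous_exp.comp (continuous_groundPhase K))
    fun_prop
  -- After squaring, this room costs `exp (ε ‖v‖² / 2)`, half of the coercivity of `-2 ω(v, K v)`.
  refine ⟨ε / (4 * C), by positivity, ?_⟩
  rw [memLp_two_iff_integrable_sq c1.aestronglyMeasurable, integrable_gaussMeasure_iff]
  refine integrable_mul_exp_neg_of_coercive μ (C := 1) (ε := ε / 2)
    (b := fun v => sumInvForm ω K v v - ε / 2 * ‖v‖ ^ 2)
    ((Real.continuous_exp.comp (continuous_bilin_apply ω J₀).neg).smul (c1.pow 2)) (by positivity)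
    (fun v => ?_) (fun v => by linarith [hεB v])
  have e : Real.exp (-(ω v (J₀ v))) • (Real.exp (ε / (4 * C) * (C * ‖v‖ ^ 2)) *
      ‖expFun (groundPhase ω J₀) (groundPrefactor ω J₀) K v‖) ^ 2 =
      Real.exp (-(sumInvForm ω K v v - ε / 2 * ‖v‖ ^ 2)) := by
    rw [norm_expFun_ground, ← Real.exp_add, ← Real.exp_nat_mul, smul_eq_mul, ← Real.exp_add,
      sumInvForm_apply]
    congr 1
    field_simp
    push_cast
    ring
  rw [e, Real.norm_eq_abs, Real.abs_exp]
  refine le_mul_of_one_le_left (Real.exp_pos _).le ?_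
  rw [one_mul]
  exact one_le_pow₀ (by linarith [norm_nonneg v])

/-- The exponential family of ground states as a map into the Hilbert space. -/
def groundVec (μ : Measure V) (ω : LinearMap.BilinForm ℝ V) (J₀ K : V →L[ℝ] V) :
    Lp ℂ 2 (gaussMeasure μ ω J₀) :=
  toL2 _ (expFun (groundPhase ω J₀) (groundPrefactor ω J₀) K)

theorem exists_isOpen_contDiffOn_groundVec [μ.IsAddHaarMeasure] (ω : LinearMap.BilinForm ℝ V)
    (J₀ : V →L[ℝ] V) :
    ∃ O : Set (V →L[ℝ] V), IsOpen O ∧ (∀ K, (∀ v, v ≠ 0 → ω v (K v) < 0) → K ∈ O) ∧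
      ContDiffOn ℝ (⊤ : ℕ∞) (groundVec μ ω J₀) O := by
  obtain ⟨C, hC, hq⟩ := exists_groundPhase_bound ω J₀
  have hqm : ∀ B, AEStronglyMeasurable (groundPhase ω J₀ B) (gaussMeasure μ ω J₀) :=
    fun B => (continuous_groundPhase B).aestronglyMeasurable
  have hP : AEStronglyMeasurable (groundPrefactor ω J₀) (gaussMeasure μ ω J₀) :=
    continuous_groundPrefactor.aestronglyMeasurable
  have hwm : Measurable fun v : V => C * ‖v‖ ^ 2 := by fun_prop
  have hO := isOpen_expDom hq hqm (fun v => by positivity) hwm hP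
  exact ⟨_, hO, fun K hK => expDom_ground μ hC hK,
    contDiffOn_toL2_expFun hq hqm (fun v => by positivity) hwm hP hO fun _ h => h⟩

theorem memLp_ground [μ.IsAddHaarMeasure] (hK : ∀ v, v ≠ 0 → ω v (K v) < 0) :
    MemLp (expFun (groundPhase ω J₀) (groundPrefactor ω J₀) K) 2 (gaussMeasure μ ω J₀) :=
  memLp_expFun (fun B => (continuous_groundPhase B).aestronglyMeasurable)
    (fun v => by positivity) continuous_groundPrefactor.aestronglyMeasurable
    (expDom_ground μ one_pos hK)

theorem hasFDerivAt_groundVec [μ.IsAddHaarMeasure] (hK : ∀ v, v ≠ 0 → ω v (K v) < 0) :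
    ∃ D : (V →L[ℝ] V) →L[ℝ] Lp ℂ 2 (gaussMeasure μ ω J₀),
      HasFDerivAt (groundVec μ ω J₀) D K ∧ ∀ B, D B =ᵐ[gaussMeasure μ ω J₀] fun v =>
        groundPhase ω J₀ B v * expFun (groundPhase ω J₀) (groundPrefactor ω J₀) K v := by
  obtain ⟨C, hC, hq⟩ := exists_groundPhase_bound ω J₀
  have hqm : ∀ B, AEStronglyMeasurable (groundPhase ω J₀ B) (gaussMeasure μ ω J₀) :=
    fun B => (continuous_groundPhase B).aestronglyMeasurable
  have hP : AEStronglyMeasurable (groundPrefactor ω J₀) (gaussMeasure μ ω J₀) :=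
    continuous_groundPrefactor.aestronglyMeasurable
  have hwm : Measurable fun v : V => C * ‖v‖ ^ 2 := by fun_prop
  have hdom := expDom_ground (J₀ := J₀) μ hC hK
  obtain ⟨D, hD, h⟩ := hasFDerivAt_toL2_expFun hq hqm (fun v => by positivity) hwm hP hdom
  refine ⟨D, h, fun B => ?_⟩
  rw [hD]
  refine (coeFn_toL2 (memLp_expFun hqm (fun v => by positivity) (hP.mul (hqm B))
    (hdom.mul_phase hq hqm hwm hP B))).trans (Eventually.of_forall fun v => ?_)
  simp only [expFun, Pi.mul_apply]
  ring

/-- The weight and the squared modulus of the ground state merge into one Gaussian for `μ`, so inner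
products become Gaussian moments. -/
theorem inner_groundVec_of_ae_eq [μ.IsAddHaarMeasure] (hK : ∀ v, v ≠ 0 → ω v (K v) < 0)
    {F : Lp ℂ 2 (gaussMeasure μ ω J₀)} {c : V → ℂ} (hF : F =ᵐ[gaussMeasure μ ω J₀] fun v =>
      c v * expFun (groundPhase ω J₀) (groundPrefactor ω J₀) K v) :
    inner ℂ (groundVec μ ω J₀ K) F =
      ∫ v, c v * (Real.exp (-(sumInvForm ω K v v)) : ℂ) ∂μ := by
  set f := expFun (groundPhase ω J₀) (groundPrefactor ω J₀) K with hf
  have h1 : inner ℂ (groundVec μ ω J₀ K) F =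
      ∫ v, c v * ((‖f v‖ ^ 2 : ℝ) : ℂ) ∂gaussMeasure μ ω J₀ := by
    rw [L2.inner_def]
    refine integral_congr_ae ?_
    filter_upwards [hF, coeFn_toL2 (memLp_ground (J₀ := J₀) μ hK)] with v h2 h3
    rw [h2, groundVec, h3, RCLike.inner_apply, mul_assoc, RCLike.mul_conj]
    simp [hf]
  rw [h1, integral_gaussMeasure]
  refine integral_congr_ae (Eventually.of_forall fun v => ?_)
  have e : Real.exp (-(ω v (J₀ v))) * ‖f v‖ ^ 2 = Real.exp (-(sumInvForm ω K v v)) := by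
    rw [hf, norm_expFun_ground, ← Real.exp_nat_mul, ← Real.exp_add, sumInvForm_apply]
    congr 1
    push_cast
    ring
  dsimp only
  rw [← e, Complex.real_smul, Complex.ofReal_mul]
  ring

theorem inner_groundVec_self [μ.IsAddHaarMeasure] (hK : ∀ v, v ≠ 0 → ω v (K v) < 0) :
    inner ℂ (groundVec μ ω J₀ K) (groundVec μ ω J₀ K) =
      ((∫ v, Real.exp (-(sumInvForm ω K v v)) ∂μ : ℝ) : ℂ) := by
  rw [inner_groundVec_of_ae_eq (c := fun _ => 1) μ hK, ← integral_complex_ofReal]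
  · simp
  · simpa [groundVec] using coeFn_toL2 (memLp_ground μ hK)

theorem groundVec_ne_zero [μ.IsAddHaarMeasure] (hK : ∀ v, v ≠ 0 → ω v (K v) < 0) :
    groundVec μ ω J₀ K ≠ 0 := by
  rw [← inner_self_ne_zero (𝕜 := ℂ), inner_groundVec_self μ hK, Complex.ofReal_ne_zero]
  exact (integral_exp_neg_pos μ fun v hv => by
    rw [sumInvForm_apply]
    linarith [hK v hv]).ne'

theorem groundLine_eq_span [μ.IsAddHaarMeasure] (hω : ω.IsAlt) (hJ₀ : J₀ ∈ compatibleJ ω)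
    (hJ : J ∈ compatibleJ ω) :
    groundLine μ ω J₀ J = Submodule.span ℂ {groundVec μ ω J₀ (sumInv J₀ J)} := by
  have hK : ∀ v, v ≠ 0 → ω v (sumInv J₀ J v) < 0 := fun v hv => sumInv_neg hω hJ₀ hJ hv
  have hv := coeFn_toL2 (memLp_ground (J₀ := J₀) μ hK)
  obtain ⟨h1, h2⟩ := isHolo_ground hω hJ₀ hJ
  apply le_antisymm
  · rintro F ⟨f, hf, hFf, hk⟩
    rw [ground_equation_iff hJ₀ hJ hf] at hk
    refine Submodule.mem_span_singleton.2 ⟨f 0, Lp.ext ?_⟩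
    filter_upwards [Lp.coeFn_smul (f 0) (groundVec μ ω J₀ (sumInv J₀ J)), hv, hFf]
      with v e1 e2 e3
    rw [e1, e3, Pi.smul_apply, groundVec, e2, eq_smul_ground hω hJ₀ hJ hf.1 hk v, smul_eq_mul]
  · rw [Submodule.span_singleton_le_iff_mem]
    exact ⟨_, h1, hv, (ground_equation_iff hJ₀ hJ h1).2 h2⟩

/-- The connection form of the section `groundVec`. -/
def groundConnection (J₀ J X : V →L[ℝ] V) : ℂ :=
  ((1 / 4 * opTrace (X * sumInv J₀ J) : ℝ) : ℂ) +
    Complex.I * ((1 / 4 * opTrace (J₀ * sumInv J₀ J * X) : ℝ) : ℂ)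

theorem integral_groundPhase [μ.IsAddHaarMeasure] (hω : ω.IsAlt) (hJ₀ : J₀ ∈ compatibleJ ω)
    (hJ : J ∈ compatibleJ ω) (X : V →L[ℝ] V) :
    ∫ v, groundPhase ω J₀ (-(sumInv J₀ J * X * sumInv J₀ J)) v *
        (Real.exp (-(sumInvForm ω (sumInv J₀ J) v v)) : ℂ) ∂μ =
      groundConnection J₀ J X *
        ((∫ v, Real.exp (-(sumInvForm ω (sumInv J₀ J) v v)) ∂μ : ℝ) : ℂ) := by
  set K := sumInv J₀ J with hKdef
  set B := sumInvForm ω K with hBdef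
  have hB : ∀ v, v ≠ 0 → 0 < B v v := fun v hv => by
    rw [hBdef, sumInvForm_apply]
    linarith [sumInv_neg hω hJ₀ hJ hv]
  have hs : ∀ u v, B u v = B v u := fun u v => by
    rw [hBdef, sumInvForm_apply, sumInvForm_apply, sumInv_symm hω hJ₀ hJ]
  have c1 : ∀ v, J₀ (K v) = K (J v) := fun v => DFunLike.congr_fun (mul_sumInv hJ₀ hJ) v
  -- The direction `-K X K` is the derivative of `K` along `X`. Its outer factor `K` is absorbed
  -- into `B`, after `J₀ K = K J` in the imaginary part.
  have e : ∀ v, groundPhase ω J₀ (-(K * X * K)) v * (Real.exp (-(B v v)) : ℂ) =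
      ((1 / 2 * (B v ((X * K) v) * Real.exp (-(B v v))) : ℝ) : ℂ) +
        Complex.I * ((1 / 2 * (B v ((J * X * K) v) * Real.exp (-(B v v))) : ℝ) : ℂ) := fun v => by
    change Complex.I * ((ω v (J₀ (-(K (X (K v))))) : ℂ) -
      Complex.I * (ω v (-(K (X (K v)))) : ℂ)) * _ = _
    simp only [hBdef, sumInvForm_apply, mul_apply_eq_comp, map_neg, c1]
    push_cast
    ring_nf
    simp only [Complex.I_sq]
    ring
  have i1 : ∀ C : V →L[ℝ] V, Integrable (fun v => 1 / 2 * (B v (C v) * Real.exp (-(B v v)))) μ :=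
    fun C => (integrable_bilin_mul_exp_neg μ hB (B.compl₂ C.toLinearMap)).const_mul _
  have i2 : ∀ C : V →L[ℝ] V, ∫ v, 1 / 2 * (B v (C v) * Real.exp (-(B v v))) ∂μ =
      1 / 4 * opTrace C * ∫ v, Real.exp (-(B v v)) ∂μ := fun C => by
    have := integral_bilin_comp_mul_exp_neg μ hB hs C.toLinearMap
    rw [integral_const_mul]
    refine (congrArg (1 / 2 * ·) this).trans ?_
    rw [opTrace_apply]
    ring
  simp only [e]
  rw [integral_add (i1 _).ofReal ((i1 _).ofReal.const_mul _), integral_const_mul,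
    integral_complex_ofReal, integral_complex_ofReal, i2, i2, groundConnection, ← hKdef,
    mul_sumInv hJ₀ hJ, ← hKdef, mul_assoc K J X, ← opTrace_mul_comm (J * X) K]
  push_cast
  ring

theorem exists_isOpen_contDiffOn_ground [μ.IsAddHaarMeasure] (hω : ω.IsAlt)
    (hJ₀ : J₀ ∈ compatibleJ ω) :
    ∃ O : Set (V →L[ℝ] V), IsOpen O ∧ compatibleJ ω ⊆ O ∧
      ContDiffOn ℝ (⊤ : ℕ∞) (fun J => groundVec μ ω J₀ (sumInv J₀ J)) O := by
  obtain ⟨O, hO, hmem, hd⟩ := exists_isOpen_contDiffOn_groundVec μ ω J₀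
  obtain ⟨hU, hdU⟩ := isOpen_contDiffOn_sumInv J₀
  refine ⟨_, hdU.continuousOn.isOpen_inter_preimage hU hO, fun J hJ =>
    ⟨isUnit_add_of_mem_compatibleJ hJ₀ hJ, hmem _ fun v hv => sumInv_neg hω hJ₀ hJ hv⟩, ?_⟩
  exact hd.comp (hdU.mono Set.inter_subset_left) fun J hJ => hJ.2

theorem inner_fderiv_groundVec [μ.IsAddHaarMeasure] (hω : ω.IsAlt) (hJ₀ : J₀ ∈ compatibleJ ω)
    (hJ : J ∈ compatibleJ ω) (X : V →L[ℝ] V) :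
    inner ℂ (groundVec μ ω J₀ (sumInv J₀ J))
        (fderiv ℝ (fun J => groundVec μ ω J₀ (sumInv J₀ J)) J X) =
      groundConnection J₀ J X * inner ℂ (groundVec μ ω J₀ (sumInv J₀ J))
        (groundVec μ ω J₀ (sumInv J₀ J)) := by
  have hK : ∀ v, v ≠ 0 → ω v (sumInv J₀ J v) < 0 := fun v hv => sumInv_neg hω hJ₀ hJ hv
  obtain ⟨D, hD, hDe⟩ := hasFDerivAt_groundVec (J₀ := J₀) μ hK
  obtain ⟨D', hD', hDe'⟩ := hasFDerivAt_sumInv hJ₀ hJ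
  have h := hD.comp J hD'
  rw [show fderiv ℝ (fun J => groundVec μ ω J₀ (sumInv J₀ J)) J = D ∘L D' from h.fderiv,
    ContinuousLinearMap.comp_apply, hDe', inner_groundVec_of_ae_eq μ hK (hDe _),
    integral_groundPhase μ hω hJ₀ hJ, inner_groundVec_self μ hK]

end GroundVec

/-! ### The curvature of the `L²` connection -/

section Curvature

open Filter Topology

variable {V : Type*} [NormedAddCommGroup V] [NormedSpace ℝ V] [FiniteDimensional ℝ V]
  {ω : LinearMap.BilinForm ℝ V} {J₀ : V →L[ℝ] V}

/-- The coefficients of the connection form along a family of complex structures. -/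
theorem pd_groundConnection {k : ℕ} {γ : (Fin k → ℝ) → (V →L[ℝ] V)} {p : Fin k → ℝ}
    (hJ₀ : J₀ ∈ compatibleJ ω) (hγ : ContDiffAt ℝ (⊤ : ℕ∞) γ p) (hp : γ p ∈ compatibleJ ω)
    (i j : Fin k) :
    DifferentiableAt ℝ (fun q => groundConnection J₀ (γ q) (pd j γ q)) p ∧
    pd i (fun q => groundConnection J₀ (γ q) (pd j γ q)) p =
      ((1 / 4 * (opTrace (pd i (pd j γ) p * sumInv J₀ (γ p)) -
        opTrace (pd j γ p * sumInv J₀ (γ p) * pd i γ p * sumInv J₀ (γ p))) : ℝ) : ℂ) +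
      Complex.I * ((1 / 4 * (opTrace (J₀ * sumInv J₀ (γ p) * pd i (pd j γ) p) -
        opTrace (J₀ * sumInv J₀ (γ p) * pd i γ p * sumInv J₀ (γ p) * pd j γ p)) : ℝ) : ℂ) := by
  obtain ⟨D, hD, hDe⟩ := hasFDerivAt_sumInv hJ₀ hp
  have hγd : DifferentiableAt ℝ γ p := hγ.differentiableAt (by simp)
  have hγ' : DifferentiableAt ℝ (pd j γ) p := hγ.pd.differentiableAt (by simp)
  have hκ : HasFDerivAt (fun q => sumInv J₀ (γ q)) (D ∘L fderiv ℝ γ p) p :=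
    hD.comp p hγd.hasFDerivAt
  have hκpd : pd i (fun q => sumInv J₀ (γ q)) p =
      -(sumInv J₀ (γ p) * pd i γ p * sumInv J₀ (γ p)) := by
    rw [pd, hκ.fderiv]
    exact hDe _
  have hκd := hκ.differentiableAt
  let L₁ : (V →L[ℝ] V) →L[ℝ] ℂ := Complex.ofRealCLM ∘L ((1 / 4 : ℝ) • opTrace)
  let L₂ : (V →L[ℝ] V) →L[ℝ] ℂ := Complex.I • L₁
  have e : (fun q => groundConnection J₀ (γ q) (pd j γ q)) = fun q =>
      L₁ (pd j γ q * sumInv J₀ (γ q)) + L₂ (J₀ * sumInv J₀ (γ q) * pd j γ q) := rfl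
  have d1 : DifferentiableAt ℝ (fun q => pd j γ q * sumInv J₀ (γ q)) p := hγ'.mul hκd
  have d2 : DifferentiableAt ℝ (fun q => J₀ * sumInv J₀ (γ q)) p :=
    (differentiableAt_const J₀).mul hκd
  have d3 : DifferentiableAt ℝ (fun q => J₀ * sumInv J₀ (γ q) * pd j γ q) p := d2.mul hγ'
  have d4 : DifferentiableAt ℝ (fun q => L₁ (pd j γ q * sumInv J₀ (γ q))) p :=
    L₁.differentiableAt.comp p d1
  have d5 : DifferentiableAt ℝ (fun q => L₂ (J₀ * sumInv J₀ (γ q) * pd j γ q)) p :=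
    L₂.differentiableAt.comp p d3
  have hc : pd i (fun _ : Fin k → ℝ => J₀) p = 0 := by simp [pd]
  rw [e]
  refine ⟨d4.add d5, ?_⟩
  rw [pd_add d4 d5, pd_clm L₁ d1, pd_clm L₂ d3, pd_mul hγ' hκd, pd_mul d2 hγ',
    pd_mul (differentiableAt_const J₀) hκd, hκpd, hc]
  have h1 : ∀ Z, L₁ Z = ((1 / 4 * opTrace Z : ℝ) : ℂ) := fun Z => rfl
  have h2 : ∀ Z, L₂ Z = Complex.I * ((1 / 4 * opTrace Z : ℝ) : ℂ) := fun Z => rfl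
  rw [h1, h2, map_add, map_add]
  simp only [zero_mul, zero_add, mul_neg, neg_mul, map_neg, ← mul_assoc]
  push_cast
  ring

theorem isCurvatureForm_ground [MeasurableSpace V] [BorelSpace V] (μ : Measure V)
    [μ.IsAddHaarMeasure] (hω : ω.IsAlt) (hJ₀ : J₀ ∈ compatibleJ ω) :
    IsCurvatureForm (compatibleJ ω) (groundLine μ ω J₀)
      (fun J X Y => Complex.I / 2 * (sympForm J X Y : ℂ)) := by
  intro U γ ψ hU hγ hγJ hψ hψR p hp
  obtain ⟨O, hO, hJO, hS⟩ := exists_isOpen_contDiffOn_ground μ hω hJ₀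
  have hneg : ∀ q ∈ U, ∀ v, v ≠ 0 → ω v (sumInv J₀ (γ q) v) < 0 := fun q hq v hv =>
    sumInv_neg hω hJ₀ (hγJ q hq) hv
  have hγ' : ∀ q ∈ U, ContDiffAt ℝ (⊤ : ℕ∞) γ q := fun q hq => hγ.contDiffAt (hU.mem_nhds hq)
  have key := covD_commutator (R := groundLine μ ω J₀) (γ := γ) (ψ := ψ) hU
    (s := fun q => groundVec μ ω J₀ (sumInv J₀ (γ q)))
    (a := fun i q => groundConnection J₀ (γ q) (pd i γ q))
    (hS.comp hγ fun q hq => hJO (hγJ q hq)) hψ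
    (fun q hq => groundVec_ne_zero μ (hneg q hq))
    (fun q hq => groundLine_eq_span μ hω hJ₀ (hγJ q hq)) hψR
    (fun i q hq => by
      rw [← inner_fderiv_groundVec μ hω hJ₀ (hγJ q hq)]
      have hSd : DifferentiableAt ℝ (fun J => groundVec μ ω J₀ (sumInv J₀ J)) (γ q) :=
        (hS.contDiffAt (hO.mem_nhds (hJO (hγJ q hq)))).differentiableAt (by simp)
      exact congrArg (inner ℂ _) (pd_comp hSd ((hγ' q hq).differentiableAt (by simp))))
    (fun i q hq => (pd_groundConnection hJ₀ (hγ' q hq) (hγJ q hq) i i).1) hp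
  rw [key]
  congr 1
  dsimp only
  have ha : ∀ i, γ p * pd i γ p = -(pd i γ p * γ p) := fun i =>
    pd_anticommute ((hγ' p hp).differentiableAt (by simp))
      (eventually_of_mem (hU.mem_nhds hp) fun q hq => mul_self_of_mem_compatibleJ (hγJ q hq))
  have hc := opTrace_sumInv_curvature hJ₀ (hγJ p hp) (ha 0) (ha 1)
  -- This symmetry expresses closedness of the real part of the connection form; only the imaginary
  -- part contributes curvature.
  have hsym : opTrace (pd 1 γ p * sumInv J₀ (γ p) * pd 0 γ p * sumInv J₀ (γ p)) =
      opTrace (pd 0 γ p * sumInv J₀ (γ p) * pd 1 γ p * sumInv J₀ (γ p)) := by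
    rw [mul_assoc _ (pd 0 γ p), opTrace_mul_comm, mul_assoc _ (pd 1 γ p)]
  rw [(pd_groundConnection hJ₀ (hγ' p hp) (hγJ p hp) 0 1).2,
    (pd_groundConnection hJ₀ (hγ' p hp) (hγJ p hp) 1 0).2, hsym,
    pd_comm (i := 1) (j := 0) (hγ' p hp),
    show sympForm (γ p) (pd 0 γ p) (pd 1 γ p) = 1 / 2 * (2 * sympForm (γ p) (pd 0 γ p) (pd 1 γ p))
      by ring, ← hc]
  push_cast
  ring

end Curvature

end

theorem mainTheorem5 {V : Type*} [NormedAddCommGroup V] [NormedSpace ℝ V] [FiniteDimensional ℝ V]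
    [MeasurableSpace V] [BorelSpace V]
    (μ : Measure V) [μ.IsAddHaarMeasure]
    (ω : LinearMap.BilinForm ℝ V) (hω : ω.IsAlt) (hnd : ω.Nondegenerate)
    (J₀ : V →L[ℝ] V) (hJ₀ : J₀ ∈ compatibleJ ω) :
    IsSmoothLineBundle (compatibleJ ω) (groundLine μ ω J₀) ∧
    IsInvariantSymplecticForm ω sympForm ∧
    IsCurvatureForm (compatibleJ ω) (groundLine μ ω J₀)
      (fun J X Y => Complex.I / 2 * (sympForm J X Y : ℂ)) := by
  obtain ⟨O, hO, hJO, hS⟩ := exists_isOpen_contDiffOn_ground μ hω hJ₀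
  exact ⟨isSmoothLineBundle_of_section hO hJO hS
      (fun J hJ => groundVec_ne_zero μ fun v hv => sumInv_neg hω hJ₀ hJ hv)
      (fun J hJ => groundLine_eq_span μ hω hJ₀ hJ),
    isInvariantSymplecticForm_sympForm hω, isCurvatureForm_ground μ hω hJ₀⟩
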